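/- **Setting.** A (finite) Markov decision process (MDP) is $G=(S,A,\mathit{Act},\delta,s_0)$ with finite sets $S$ of states and $A$ of actions, nonempty sets $\mathit{Act}(s)\subseteq A$ of enabled actions ($s\in S$) such that every action is enabled in exactly one state, a transition function $\delta:A\to\mathit{Dist}(S)$, and an initial state $s_0\in S$. A strategy with countable set $M$ of memory elements is a triple $\sigma=(\sigma_u,\sigma_n,\alpha)$ with memory update $\sigma_u:A\times S\times M\to\mathit{Dist}(M)$, next move $\sigma_n:S\times M\to\mathit{Dist}(A)$ with $\sigma_n(s,m)$ supported on $\mathit{Act}(s)$, and initial distribution $\alpha\in\mathit{Dist}(M)$; since $\sigma_u$ and $\alpha$ need not be Dirac, such strategies are called stochastic-update. It induces the Markov chain on $S\times M\times A$ with initial probabilities $\mathbf 1[s=s_0]\,\alpha(m)\,\sigma_n(s,m)(a)$ and transition probabilities from $(s,m,a)$ to $(s',m',a')$ equal to $\delta(a)(s')\,\sigma_u(a,s',m)(m')\,\sigma_n(s',m')(a')$. Let $\Pr^\sigma$ and $\mathbb E^\sigma$ be the probability measure on its runs and the expectation, and let $A_t$ be the action of the $t$-th location of a run ($t=1,2,\dots$).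 For a reward function $r:A\to\mathbb Q^n$ ($n\in\mathbb N$) let $\mathrm{lr}_{\inf}(r)_i=\liminf_{T\to\infty}\frac1T\sum_{t=1}^T r(A_t)_i$ for $i\in[n]=\{1,\dots,n\}$; inequalities between vectors are componentwise. For vectors $e,\mathit{sat},\widetilde{\mathit{sat}}$ and probabilities $\mathit{pr}\in[0,1]^n$, $p,\tilde p\in[0,1]$, consider the constraints * (EXP) $\mathbb E^\sigma[\mathrm{lr}_{\inf}(r)_i]\ge e_i$ for all $i\in[n]$; * (conjunctive-SAT) $\Pr^\sigma[\mathrm{lr}_{\inf}(r)_i\ge \mathit{sat}_i]\ge \mathit{pr}_i$ for all $i\in[n]$; * (joint-SAT) $\Pr^\sigma[\mathrm{lr}_{\inf}(r)\ge \mathit{sat}]\ge p$. The problems are: *multi-quant-conjunctive*: (EXP) and (conjunctive-SAT); *multi-qual*: the same with $\mathit{pr}=(1,\dots,1)$; *multi-quant-joint*: (EXP) and (joint-SAT); *multi-quant-conjunctive-joint*: (EXP), (conjunctive-SAT) and in addition $\Pr^\sigma[\mathrm{lr}_{\inf}(r)\ge\widetilde{\mathit{sat}}]\ge\tilde p$.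 In an instance, $e,\mathit{sat},\widetilde{\mathit{sat}},\mathit{pr},\tilde p$ are rational ($p$ may be real). An instance is realizable if some strategy (with some countable memory) satisfies its constraints. For $\varepsilon>0$, an $\varepsilon$-witness strategy is a strategy satisfying the constraints in which every $e_i$, $\mathit{sat}_i$ and $\widetilde{\mathit{sat}}_i$ is lowered by $\varepsilon$ (the probabilities $\mathit{pr}_i,p,\tilde p$ are unchanged). **Theorem.** For every MDP $G$, every $n\in\mathbb N$, every $r:A\to\mathbb Q^n$ and every $\varepsilon>0$: each realizable instance of one of these problems for $G$ and $r$ has a (stochastic-update) $\varepsilon$-witness strategy whose memory set has exactly * $2$ elements, for multi-qual; * $3$ elements, for multi-quant-joint; * $2^n+1$ elements, for multi-quant-conjunctive; * $2^{n+1}+1$ elements, for multi-quant-conjunctive-joint. -/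

import Mathlib

open MeasureTheory ProbabilityTheory Filter

noncomputable section

/-! ### Markov chains -/

/-- A Markov chain on a set `L` of locations: transition function and initial distribution.
(Distributions on a countable set are `PMF`s.) -/
structure MarkovChain (L : Type*) where
  /-- the transition function -/
  P : L → PMF L
  /-- the initial distribution -/
  μ : PMF L

namespace MarkovChain

variable {L : Type*} [MeasurableSpace L] [DiscreteMeasurableSpace L]

/-- The one-step Markov kernel of the chain. -/
def kernel (C : MarkovChain L) : Kernel L L where
  toFun := fun l => (C.P l).toMeasure
  measurable' := Measurable.of_discrete

instance (C : MarkovChain L) : IsMarkovKernel C.kernel :=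
  ⟨fun l => PMF.toMeasure.isProbabilityMeasure (C.P l)⟩

/-- The kernel giving the law of the `(k+1)`-st location from the history up to time `k`: it
depends on the `k`-th location only. -/
def histKernel (C : MarkovChain L) (k : ℕ) :
    Kernel ((_i : Finset.Iic k) → L) L :=
  C.kernel.comap (fun h => h ⟨k, Finset.mem_Iic.2 le_rfl⟩) (measurable_pi_apply _)

instance (C : MarkovChain L) (k : ℕ) : IsMarkovKernel (C.histKernel k) := by
  unfold histKernel; infer_instance

/-- The probability measure on runs `ω = ω 0, ω 1, …`, see `measure_cone`. -/
def measure (C : MarkovChain L) : Measure (ℕ → L) :=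
  Kernel.trajMeasure (X := fun _ => L) C.μ.toMeasure C.histKernel

instance (C : MarkovChain L) : IsProbabilityMeasure C.measure := by
  unfold measure; infer_instance

/-- The measure of runs is the one determined by the probabilities of the cones. -/
theorem measure_cone [Countable L] (C : MarkovChain L) (w : ℕ → L) (k : ℕ) :
    C.measure {ω | ∀ i ≤ k, ω i = w i} =
      C.μ (w 0) * ∏ i ∈ Finset.range k, C.P (w i) (w (i + 1)) := by
  induction k with
  | zero =>
    have h0 : C.measure.map (Preorder.frestrictLe (π := fun _ : ℕ => L) 0) =
        C.μ.toMeasure.map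
          (MeasurableEquiv.piUnique (fun _ : Finset.Iic 0 => L)).symm := by
      unfold measure Kernel.trajMeasure
      rw [Measure.map_comp _ _ (by fun_prop), Kernel.traj_map_frestrictLe,
        Kernel.partialTraj_self, Measure.id_comp]
    have hB : MeasurableSet ((fun h : (_i : Finset.Iic 0) → L => h default) ⁻¹' {w 0}) :=
      (measurable_pi_apply _) (measurableSet_singleton (w 0))
    have h1 : {ω : ℕ → L | ∀ i ≤ 0, ω i = w i} =
        Preorder.frestrictLe (π := fun _ : ℕ => L) 0 ⁻¹'
          ((fun h : (_i : Finset.Iic 0) → L => h default) ⁻¹' {w 0}) := by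
      ext ω
      simp only [Set.mem_ofPred_eq, Set.mem_preimage, Nat.le_zero, forall_eq]
      rfl
    rw [h1, ← Measure.map_apply (by fun_prop) hB, h0, Measure.map_apply (by fun_prop) hB]
    have h2 : (MeasurableEquiv.piUnique (fun _ : Finset.Iic 0 => L)).symm ⁻¹'
        ((fun h : (_i : Finset.Iic 0) → L => h default) ⁻¹' {w 0}) = {w 0} := by
      ext x
      simp
    rw [h2, PMF.toMeasure_apply_singleton _ _ (measurableSet_singleton _)]
    simp
  | succ k ih =>
    let B : Set ((_i : Finset.Iic k) → L) := {h | ∀ i, h i = w i}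
    have hB : MeasurableSet B := by
      have : B = ⋂ i, (fun h : (_i : Finset.Iic k) → L => h i) ⁻¹' {w i} := by
        ext h; simp [B]
      rw [this]
      exact MeasurableSet.iInter fun i => (measurable_pi_apply i) (measurableSet_singleton _)
    have h1 : {ω : ℕ → L | ∀ i ≤ k + 1, ω i = w i} =
        (fun ω : ℕ → L => (Preorder.frestrictLe (π := fun _ : ℕ => L) k ω, ω (k + 1))) ⁻¹'
          (B ×ˢ {w (k + 1)}) := by
      ext ω
      simp only [Set.mem_ofPred_eq, Set.mem_preimage, Set.mem_prod, Set.mem_singleton_iff, B,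
        Subtype.forall, Finset.mem_Iic, Preorder.frestrictLe_apply]
      constructor
      · intro h
        exact ⟨fun i hi => h i (by omega), h _ le_rfl⟩
      · rintro ⟨h, h'⟩ i hi
        rcases Nat.le_succ_iff.1 hi with hi | rfl
        · exact h i hi
        · exact h'
    have h2 : {ω : ℕ → L | ∀ i ≤ k, ω i = w i} =
        Preorder.frestrictLe (π := fun _ : ℕ => L) k ⁻¹' B := by
      ext ω
      simp [B]
    have hmap := Kernel.map_frestrictLe_trajMeasure_compProd_eq_map_trajMeasure
      (X := fun _ : ℕ => L) (μ₀ := C.μ.toMeasure) (κ := C.histKernel) (a := k)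
    rw [h2, ← Measure.map_apply (by fun_prop) hB] at ih
    rw [h1, ← Measure.map_apply (by fun_prop) (hB.prod (measurableSet_singleton _))]
    unfold measure at ih ⊢
    rw [← hmap, Measure.compProd_apply_prod hB (measurableSet_singleton _)]
    have h3 : ∀ h ∈ B, C.histKernel k h {w (k + 1)} = C.P (w k) (w (k + 1)) := by
      intro h hh
      have : h ⟨k, Finset.mem_Iic.2 le_rfl⟩ = w k := hh _
      rw [histKernel, Kernel.comap_apply, this]
      exact PMF.toMeasure_apply_singleton _ _ (measurableSet_singleton _)
    rw [setLIntegral_congr_fun hB h3, setLIntegral_const, ih, Finset.prod_range_succ]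
    ring

end MarkovChain

/-! ### Markov decision processes, strategies and plays -/

/-- A (finite) Markov decision process with states `S` and actions `A`. -/
structure MDP (S A : Type*) [Finite S] [Finite A] where
  /-- the set of actions enabled in a state -/
  Act : S → Set A
  act_nonempty : ∀ s, (Act s).Nonempty
  /-- every action is enabled in exactly one state -/
  act_partition : ∀ a, ∃! s, a ∈ Act s
  /-- the transition function -/
  δ : A → PMF S
  /-- the initial state -/
  s₀ : S

variable {S A : Type*} [Finite S] [Finite A]

/-- A strategy with set `M` of memory elements; memory update and initial memory may be
stochastic, and the next move may be randomized. -/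
structure Strategy (G : MDP S A) (M : Type*) where
  /-- the memory update function -/
  upd : A → S → M → PMF M
  /-- the next move function -/
  next : S → M → PMF A
  /-- the initial distribution on memory elements -/
  init : PMF M
  next_enabled : ∀ s m a, next s m a ≠ 0 → a ∈ G.Act s

/-- Locations `(s, m, a)` of a play. -/
@[ext]
structure Loc (S M A : Type*) where
  state : S
  mem : M
  act : A

namespace Loc

variable {S M A : Type*}

instance : MeasurableSpace (Loc S M A) := ⊤

instance : DiscreteMeasurableSpace (Loc S M A) := ⟨fun _ => trivial⟩

instance [Countable S] [Countable M] [Countable A] : Countable (Loc S M A) :=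
  Function.Injective.countable (f := fun l : Loc S M A => (l.state, l.mem, l.act)) (by
    rintro ⟨s, m, a⟩ ⟨s', m', a'⟩ h
    simpa using h)

end Loc

namespace Strategy

variable {G : MDP S A} {M : Type*}

/-- The Markov chain `G^σ`. -/
def play (σ : Strategy G M) : MarkovChain (Loc S M A) where
  P := fun l =>
    (G.δ l.act).bind fun s' =>
      (σ.upd l.act s' l.mem).bind fun m' =>
        (σ.next s' m').map fun a' => ⟨s', m', a'⟩
  μ := σ.init.bind fun m => (σ.next G.s₀ m).map fun a => ⟨G.s₀, m, a⟩

open Classical in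
theorem play_μ_apply (σ : Strategy G M) (s : S) (m : M) (a : A) :
    σ.play.μ ⟨s, m, a⟩ = (if s = G.s₀ then 1 else 0) * σ.init m * σ.next s m a := by
  simp only [play, PMF.bind_apply, PMF.map_apply, Loc.mk.injEq]
  rw [tsum_eq_single m (fun m' hm' => by simp [hm'.symm]),
    tsum_eq_single a (fun a' ha' => by simp [ha'.symm])]
  by_cases h : s = G.s₀ <;> simp [h]

theorem play_P_apply (σ : Strategy G M) (l : Loc S M A) (s' : S) (m' : M) (a' : A) :
    σ.play.P l ⟨s', m', a'⟩ = G.δ l.act s' * σ.upd l.act s' l.mem m' * σ.next s' m' a' := by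
  classical
  simp only [play, PMF.bind_apply, PMF.map_apply, Loc.mk.injEq]
  rw [tsum_eq_single s' (fun s hs => by simp [hs.symm]),
    tsum_eq_single m' (fun m hm => by simp [hm.symm]),
    tsum_eq_single a' (fun a ha => by simp [ha.symm])]
  simp [mul_assoc]

/-- The probability measure `Pr^σ` on the runs of `G^σ`. -/
def runMeasure (σ : Strategy G M) : Measure (ℕ → Loc S M A) := σ.play.measure

instance (σ : Strategy G M) : IsProbabilityMeasure σ.runMeasure := by
  unfold runMeasure; infer_instance

end Strategy

/-! ### Long-run average rewards and constraints -/

section Objectives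

variable {M : Type*} {n : ℕ}

/-- The `i`-th component of the limit-inferior long-run average reward of a run. -/
def lrInf (r : A → Fin n → ℚ) (ω : ℕ → Loc S M A) (i : Fin n) : ℝ :=
  liminf (fun T : ℕ => (∑ t ∈ Finset.range T, (r (ω t).act i : ℝ)) / (T : ℝ)) atTop

theorem measurable_lrInf (r : A → Fin n → ℚ) (i : Fin n) :
    Measurable fun ω : ℕ → Loc S M A => lrInf r ω i := by
  unfold lrInf
  refine Measurable.liminf fun T => Measurable.div_const (Finset.measurable_sum _ fun t _ => ?_) _
  exact (Measurable.of_discrete (f := fun l : Loc S M A => (r l.act i : ℝ))).comp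
    (measurable_pi_apply t)

theorem exists_abs_lrInf_le (r : A → Fin n → ℚ) (i : Fin n) :
    ∃ B : ℝ, ∀ ω : ℕ → Loc S M A, |lrInf r ω i| ≤ B := by
  obtain ⟨B, hB⟩ := (Set.finite_range fun a : A => |(r a i : ℝ)|).bddAbove
  have hB' : ∀ a, |(r a i : ℝ)| ≤ B := fun a => hB ⟨a, rfl⟩
  refine ⟨|B|, fun ω => ?_⟩
  have h : ∀ T : ℕ, |(∑ t ∈ Finset.range T, (r (ω t).act i : ℝ)) / (T : ℝ)| ≤ |B| := by
    intro T
    rcases Nat.eq_zero_or_pos T with rfl | hT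
    · simp
    have hT' : (0 : ℝ) < T := by exact_mod_cast hT
    rw [abs_div, abs_of_pos hT', div_le_iff₀ hT']
    calc |∑ t ∈ Finset.range T, (r (ω t).act i : ℝ)|
        ≤ ∑ t ∈ Finset.range T, |(r (ω t).act i : ℝ)| := Finset.abs_sum_le_sum_abs _ _
      _ ≤ ∑ _t ∈ Finset.range T, |B| :=
          Finset.sum_le_sum fun t _ => (hB' _).trans (le_abs_self B)
      _ = |B| * T := by simp [mul_comm]
  have hb : IsBoundedUnder (· ≤ ·) atTop
      fun T : ℕ => (∑ t ∈ Finset.range T, (r (ω t).act i : ℝ)) / (T : ℝ) :=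
    isBoundedUnder_of ⟨|B|, fun T => (abs_le.1 (h T)).2⟩
  have hb' : IsBoundedUnder (· ≥ ·) atTop
      fun T : ℕ => (∑ t ∈ Finset.range T, (r (ω t).act i : ℝ)) / (T : ℝ) :=
    isBoundedUnder_of ⟨-|B|, fun T => (abs_le.1 (h T)).1⟩
  refine abs_le.2 ⟨?_, ?_⟩
  · exact le_liminf_of_le hb.isCoboundedUnder_ge (Eventually.of_forall fun T => (abs_le.1 (h T)).1)
  · exact liminf_le_of_frequently_le (Frequently.of_forall fun T => (abs_le.1 (h T)).2) hb'

variable {G : MDP S A}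

theorem integrable_lrInf (σ : Strategy G M) (r : A → Fin n → ℚ) (i : Fin n) :
    Integrable (fun ω => lrInf r ω i) σ.runMeasure := by
  obtain ⟨B, hB⟩ := exists_abs_lrInf_le (S := S) (M := M) r i
  exact Integrable.of_bound (measurable_lrInf r i).aestronglyMeasurable B
    (Eventually.of_forall fun ω => hB ω)

/-- Expectation constraint. -/
def MeetsExp (σ : Strategy G M) (r : A → Fin n → ℚ) (e : Fin n → ℝ) : Prop :=
  ∀ i, e i ≤ ∫ ω, lrInf r ω i ∂σ.runMeasure

/-- Conjunctive satisfaction constraint. -/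
def MeetsConjunctiveSat (σ : Strategy G M) (r : A → Fin n → ℚ) (sat p : Fin n → ℝ) : Prop :=
  ∀ i, p i ≤ σ.runMeasure.real {ω | sat i ≤ lrInf r ω i}

/-- Joint satisfaction constraint. -/
def MeetsJointSat (σ : Strategy G M) (r : A → Fin n → ℚ) (sat : Fin n → ℝ) (p : ℝ) : Prop :=
  p ≤ σ.runMeasure.real {ω | ∀ i, sat i ≤ lrInf r ω i}

/-- Requirements of (multi-quant-conjunctive). -/
def MultiQuantConjunctive (r : A → Fin n → ℚ) (e sat pr : Fin n → ℝ)
    (σ : Strategy G M) : Prop :=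
  MeetsExp σ r e ∧ MeetsConjunctiveSat σ r sat pr

/-- Requirements of (multi-qual): all probability thresholds are `1`. -/
def MultiQual (r : A → Fin n → ℚ) (e sat : Fin n → ℝ) (σ : Strategy G M) : Prop :=
  MultiQuantConjunctive r e sat (fun _ => 1) σ

/-- Requirements of (multi-quant-joint). -/
def MultiQuantJoint (r : A → Fin n → ℚ) (e sat : Fin n → ℝ) (p : ℝ)
    (σ : Strategy G M) : Prop :=
  MeetsExp σ r e ∧ MeetsJointSat σ r sat p

/-- Requirements of (multi-quant-conjunctive-joint). -/
def MultiQuantConjunctiveJoint (r : A → Fin n → ℚ) (e sat pr sat' : Fin n → ℝ) (p' : ℝ)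
    (σ : Strategy G M) : Prop :=
  MeetsExp σ r e ∧ MeetsConjunctiveSat σ r sat pr ∧ MeetsJointSat σ r sat' p'

end Objectives

/-- Some strategy over some countable memory meets the requirements `R`. -/
def Realizable (G : MDP S A) (R : ∀ {M : Type}, Strategy G M → Prop) : Prop :=
  ∃ (M : Type) (_ : Countable M) (σ : Strategy G M), R σ

/-- Some (stochastic-update) strategy with exactly `k` memory elements meets the
requirements `R`. -/
def RealizableWithMemory (G : MDP S A) (k : ℕ) (R : ∀ {M : Type}, Strategy G M → Prop) : Prop :=
  ∃ σ : Strategy G (Fin k), R σ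

end

open Topology

/-! ### Strong law for bounded martingale differences -/

section MartingaleDifferences

variable {Ω : Type*} {mΩ : MeasurableSpace Ω} {μ : Measure Ω} [IsProbabilityMeasure μ]
  {ℱ : Filtration ℕ mΩ} {D : ℕ → Ω → ℝ} {c : ℝ}

/-! A strategy is compressed into finitely many flow vectors, and the flows are turned back into a
small strategy.

Sort the runs of the given strategy into `m` classes, according to which satisfaction constraints
they meet, and according to the maximal end component `C` in which they almost surely end up
(`Strategy.ae_exists_mec`). On each piece `E (C, k)` take the limit `x (C, k)` of the expected
action frequencies along an ultrafilter. The strong law makes `x (C, k)` a circulation; it is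
supported on `C`, its total is the probability of the piece, and by Fatou the integral of the
long-run reward over the piece is at most the reward of `x (C, k)`. Moreover, some nonnegative
transient flow `y` carries one unit from the initial state to the flows `x (C, k)`
(`IsFreqLimit.exists_flow`). The time-averaged occupation vectors satisfy this equation for each
finite horizon; they need not converge, but a finitely generated cone is closed, so the limit
equation still has a solution.

Conversely, such a `Plan` is realized with `m + 1` memory elements. Memory `0` moves in proportion
to `y` and, on every arrival in a state, switches to mode `k` with probability proportional to the
flow of `x` there; mode `k` then plays a fixed randomized choice inside its end component forever.
The expected time spent in transient mode is at most the total of `y`, hence finite, and the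
probability of ending in `(C, k)` is exactly the total of `x (C, k)` (`Plan.measureReal_absorbed`).

The error `ε` pays for connectedness. The normalized `x (C, k)` may split into several recurrent
classes; mixing in a little of a circulation with full support gives a distribution `π` for which
the mode is irreducible on `C`. Frequencies then converge to `π` from any entry state
(`Plan.ae_tendsto_freq`), so the reward is constant on each piece. If all runs in a piece have
reward at least `c`, so does their mean, and the constant reward is at least `c - ε`. Thus
probabilities are kept, while rewards lose at most `ε` (`exists_strategy_of_classification`).

Memory is one more than the number of classes: one class when all constraints hold almost surely,
and `2 ^ d` classes for `d` constraints in general. -/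

theorem stronglyMeasurable_sum_martingaleDiff
    (hD : ∀ k, StronglyMeasurable[ℱ (k + 1)] (D k)) (T : ℕ) :
    StronglyMeasurable[ℱ T] (fun ω => ∑ k ∈ Finset.range T, D k ω) :=
  Finset.stronglyMeasurable_fun_sum _ fun k hk =>
    (hD k).mono (ℱ.mono (Finset.mem_range.1 hk))

theorem abs_sum_martingaleDiff_le (hb : ∀ k ω, |D k ω| ≤ c) (T : ℕ) (ω : Ω) :
    |∑ k ∈ Finset.range T, D k ω| ≤ T * c :=
  (Finset.abs_sum_le_sum_abs _ _).trans
    ((Finset.sum_le_sum fun k _ => hb k ω).trans (by simp))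

/-- Martingale differences are orthogonal: the cross term vanishes after conditioning on the past,
so second moments grow only linearly. -/
theorem integral_sq_sum_martingaleDiff_le (hD : ∀ k, StronglyMeasurable[ℱ (k + 1)] (D k))
    (hb : ∀ k ω, |D k ω| ≤ c) (h0 : ∀ k, μ[D k | ℱ k] =ᵐ[μ] 0) (T : ℕ) :
    ∫ ω, (∑ k ∈ Finset.range T, D k ω) ^ 2 ∂μ ≤ T * c ^ 2 := by
  induction T with
  | zero => simp
  | succ T ih =>
    have hDm : StronglyMeasurable (D T) := (hD T).mono (ℱ.le _)
    have hSm : StronglyMeasurable (fun ω => ∑ k ∈ Finset.range T, D k ω) :=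
      (stronglyMeasurable_sum_martingaleDiff hD T).mono (ℱ.le _)
    have hS := abs_sum_martingaleDiff_le hb T
    have iD : Integrable (D T) μ := Integrable.of_bound hDm.aestronglyMeasurable c
      (Eventually.of_forall fun ω => hb T ω)
    have iSD : Integrable (fun ω => (∑ k ∈ Finset.range T, D k ω) * D T ω) μ :=
      iD.bdd_mul hSm.aestronglyMeasurable (Eventually.of_forall hS)
    have iS2 : Integrable (fun ω => (∑ k ∈ Finset.range T, D k ω) ^ 2) μ := by
      refine Integrable.of_bound (hSm.pow 2).aestronglyMeasurable ((T * c) ^ 2)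
        (Eventually.of_forall fun ω => ?_)
      rw [Real.norm_eq_abs, abs_pow]
      exact pow_le_pow_left₀ (abs_nonneg _) (hS ω) 2
    have iD2 : Integrable (fun ω => D T ω ^ 2) μ := by
      refine Integrable.of_bound (hDm.pow 2).aestronglyMeasurable (c ^ 2)
        (Eventually.of_forall fun ω => ?_)
      rw [Real.norm_eq_abs, abs_pow]
      exact pow_le_pow_left₀ (abs_nonneg _) (hb T ω) 2
    have hz : ∫ ω, (∑ k ∈ Finset.range T, D k ω) * D T ω ∂μ = 0 := by
      rw [← integral_condExp (ℱ.le T)]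
      have h1 := condExp_mul_of_stronglyMeasurable_left
        (stronglyMeasurable_sum_martingaleDiff hD T) iSD iD
      have h2 : μ[fun ω => (∑ k ∈ Finset.range T, D k ω) * D T ω | ℱ T] =ᵐ[μ] 0 := by
        refine h1.trans ?_
        filter_upwards [h0 T] with ω hω
        simp [hω]
      rw [integral_congr_ae h2]
      simp
    have hexp : ∀ ω, (∑ k ∈ Finset.range (T + 1), D k ω) ^ 2 =
        (∑ k ∈ Finset.range T, D k ω) ^ 2 +
          (2 * ((∑ k ∈ Finset.range T, D k ω) * D T ω) + D T ω ^ 2) := by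
      intro ω
      rw [Finset.sum_range_succ]
      ring
    simp_rw [hexp]
    have iSD2 : Integrable (fun ω => 2 * ((∑ k ∈ Finset.range T, D k ω) * D T ω) + D T ω ^ 2) μ :=
      (iSD.const_mul 2).add iD2
    rw [integral_add iS2 iSD2, integral_add (iSD.const_mul 2) iD2,
      integral_const_mul, hz]
    have h3 : ∫ ω, D T ω ^ 2 ∂μ ≤ c ^ 2 := by
      calc ∫ ω, D T ω ^ 2 ∂μ ≤ ∫ _ω, c ^ 2 ∂μ := by
            refine integral_mono iD2 (integrable_const _) fun ω => ?_
            exact sq_le_sq' (abs_le.1 (hb T ω)).1 (abs_le.1 (hb T ω)).2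
        _ = c ^ 2 := by simp
    push_cast
    linarith

/-- The strong law of large numbers for bounded martingale differences. -/
theorem ae_tendsto_sum_martingaleDiff_div (hD : ∀ k, StronglyMeasurable[ℱ (k + 1)] (D k))
    (hb : ∀ k ω, |D k ω| ≤ c) (h0 : ∀ k, μ[D k | ℱ k] =ᵐ[μ] 0) :
    ∀ᵐ ω ∂μ, Tendsto (fun T : ℕ => (∑ k ∈ Finset.range T, D k ω) / T) atTop (𝓝 0) := by
  have hSm : ∀ T, Measurable (fun ω => ∑ k ∈ Finset.range T, D k ω) := fun T =>
    ((stronglyMeasurable_sum_martingaleDiff hD T).mono (ℱ.le _)).measurable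
  -- Along the squares the second moments of the averages are at most `c ^ 2 / (k + 1) ^ 2`, which
  -- is summable; this gives almost sure convergence along `q`.
  set q : ℕ → ℕ := fun k => (k + 1) ^ 2 with hq
  set f : ℕ → Ω → ENNReal := fun k ω =>
    ENNReal.ofReal (((∑ j ∈ Finset.range (q k), D j ω) / q k) ^ 2) with hf
  have hfm : ∀ k, Measurable (f k) := fun k =>
    (((hSm (q k)).div_const _).pow_const 2).ennreal_ofReal
  have hq0 : ∀ k, (0 : ℝ) < q k := fun k => by simp only [hq]; positivity
  have hint : ∀ k, ∫⁻ ω, f k ω ∂μ ≤ ENNReal.ofReal (c ^ 2 * (1 / (k + 1 : ℝ) ^ 2)) := by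
    intro k
    rw [← ofReal_integral_eq_lintegral_ofReal]
    · apply ENNReal.ofReal_le_ofReal
      simp_rw [div_pow]
      rw [integral_div, div_le_iff₀ (by have := hq0 k; positivity)]
      refine (integral_sq_sum_martingaleDiff_le hD hb h0 (q k)).trans (le_of_eq ?_)
      simp only [hq]
      push_cast
      field_simp
    · refine Integrable.of_bound (((hSm (q k)).div_const _).pow_const 2).aestronglyMeasurable
        (c ^ 2) (Eventually.of_forall fun ω => ?_)
      rw [Real.norm_eq_abs, abs_pow]
      refine pow_le_pow_left₀ (abs_nonneg _) ?_ 2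
      rw [abs_div, abs_of_pos (hq0 k), div_le_iff₀ (hq0 k), mul_comm]
      exact abs_sum_martingaleDiff_le hb _ ω
    · exact Eventually.of_forall fun ω => sq_nonneg _
  have hsum : ∫⁻ ω, ∑' k, f k ω ∂μ ≠ ⊤ := by
    rw [lintegral_tsum fun k => (hfm k).aemeasurable]
    refine ne_top_of_le_ne_top ?_ (ENNReal.tsum_le_tsum hint)
    have hs : Summable fun k : ℕ => c ^ 2 * (1 / (k + 1 : ℝ) ^ 2) := by
      refine Summable.mul_left _ ?_
      have := (summable_nat_add_iff 1).2 (Real.summable_one_div_nat_pow.2 (one_lt_two))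
      simpa using this
    rw [← ENNReal.ofReal_tsum_of_nonneg (fun k => by positivity) hs]
    exact ENNReal.ofReal_ne_top
  have hae := ae_lt_top (Measurable.tsum hfm) hsum
  filter_upwards [hae] with ω hω
  have h1 : Tendsto (fun k => f k ω) atTop (𝓝 0) := ENNReal.tendsto_atTop_zero_of_tsum_ne_top hω.ne
  have h2 : Tendsto (fun k => (∑ j ∈ Finset.range (q k), D j ω) / q k) atTop (𝓝 0) := by
    have h3 := (ENNReal.continuousAt_toReal ENNReal.zero_ne_top).tendsto.comp h1
    have h4 : Tendsto (fun k => ((∑ j ∈ Finset.range (q k), D j ω) / q k) ^ 2) atTop (𝓝 0) := by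
      refine h3.congr fun k => ?_
      simp only [Function.comp, hf]
      exact ENNReal.toReal_ofReal (sq_nonneg _)
    have h5 := h4.sqrt
    simp only [Real.sqrt_sq_eq_abs, Real.sqrt_zero] at h5
    exact (tendsto_zero_iff_abs_tendsto_zero _).2 h5
  -- Adding `T * c` makes the partial sums monotone. As consecutive squares have ratio tending to
  -- `1`, convergence along `q` then extends to all `T`.
  have hmono : Monotone fun T : ℕ => (∑ k ∈ Finset.range T, D k ω) + T * c := by
    refine monotone_nat_of_le_succ fun T => ?_
    rw [Finset.sum_range_succ]
    push_cast
    linarith [(abs_le.1 (hb T ω)).1]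
  have hdiv : ∀ T : ℕ, T ≠ 0 → ((∑ k ∈ Finset.range T, D k ω) + T * c) / T =
      (∑ k ∈ Finset.range T, D k ω) / T + c := fun T hT => by
    have : (T : ℝ) ≠ 0 := by exact_mod_cast hT
    field_simp
  have hlim := tendsto_div_of_monotone_of_exists_subseq_tendsto_div _ c hmono fun a ha => by
    refine ⟨q, ?_, ?_, ?_⟩
    · have h6 : Tendsto (fun n : ℕ => (1 + 1 / ((n : ℝ) + 1)) ^ 2) atTop (𝓝 ((1 + 0) ^ 2)) :=
        (tendsto_const_nhds.add tendsto_one_div_add_atTop_nhds_zero_nat).pow 2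
      have h7 := h6.eventually (gt_mem_nhds (show ((1 : ℝ) + 0) ^ 2 < a by simpa using ha))
      filter_upwards [h7] with n hn
      have h8 : ((q (n + 1) : ℕ) : ℝ) = (1 + 1 / ((n : ℝ) + 1)) ^ 2 * q n := by
        simp only [hq]
        push_cast
        field_simp
      rw [h8]
      exact mul_le_mul_of_nonneg_right hn.le (hq0 n).le
    · exact tendsto_atTop_mono (fun n => by simp only [hq, id]; nlinarith) tendsto_id
    · have h9 := h2.add_const c
      rw [zero_add] at h9
      exact h9.congr fun k => (hdiv (q k) (by simp [hq])).symm
  have h10 := hlim.sub_const c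
  rw [sub_self] at h10
  refine h10.congr' ?_
  filter_upwards [eventually_ne_atTop 0] with T hT
  rw [hdiv T hT]
  ring

end MartingaleDifferences

/-! ### Laws for Markov chains -/

namespace MarkovChain

set_option linter.unusedSectionVars false

variable {L : Type*} [MeasurableSpace L] [DiscreteMeasurableSpace L]

/-- The probability of moving from `l` into `B` in one step. -/
noncomputable def stepProb (C : MarkovChain L) (B : Set L) (l : L) : ℝ :=
  ((C.P l).toMeasure B).toReal

theorem stepProb_nonneg (C : MarkovChain L) (B : Set L) (l : L) : 0 ≤ C.stepProb B l :=
  ENNReal.toReal_nonneg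

theorem stepProb_le_one (C : MarkovChain L) (B : Set L) (l : L) : C.stepProb B l ≤ 1 := by
  have : IsProbabilityMeasure (C.P l).toMeasure := PMF.toMeasure.isProbabilityMeasure _
  exact measureReal_le_one

theorem stepProb_singleton (C : MarkovChain L) (l l' : L) :
    C.stepProb {l'} l = (C.P l l').toReal := by
  rw [stepProb, PMF.toMeasure_apply_singleton _ _ (MeasurableSet.of_discrete)]

/-- The filtration generated by the locations. -/
noncomputable def filtration (L : Type*) [MeasurableSpace L] :
    Filtration ℕ (MeasurableSpace.pi : MeasurableSpace (ℕ → L)) :=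
  Filtration.piLE (X := fun _ : ℕ => L)

theorem measurable_filtration {i k : ℕ} (h : i ≤ k) :
    Measurable[filtration L k] fun ω : ℕ → L => ω i := by
  rw [filtration, Filtration.piLE_eq_comap_frestrictLe]
  exact (measurable_pi_apply (⟨i, Finset.mem_Iic.2 h⟩ : Finset.Iic k)).comp
    (comap_measurable (Preorder.frestrictLe (π := fun _ : ℕ => L) k))

/-- The Markov property in integrated form: the law of the history up to `k + 1` is the law up to
`k` composed with the one-step kernel. -/
theorem integral_next_indicator (C : MarkovChain L) (k : ℕ) (B : Set L)
    {H : Set (ℕ → L)} (hH : MeasurableSet[filtration L k] H) :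
    C.measure.real (H ∩ {ω | ω (k + 1) ∈ B}) = ∫ ω in H, C.stepProb B (ω k) ∂C.measure := by
  rw [filtration, Filtration.piLE_eq_comap_frestrictLe] at hH
  obtain ⟨U, hU, rfl⟩ := hH
  have hfm : Measurable (Preorder.frestrictLe (π := fun _ : ℕ => L) k) := by fun_prop
  have hm : MeasurableSet B := MeasurableSet.of_discrete
  have hmap := Kernel.map_frestrictLe_trajMeasure_compProd_eq_map_trajMeasure
    (X := fun _ : ℕ => L) (μ₀ := C.μ.toMeasure) (κ := C.histKernel) (a := k)
  have h1 : Preorder.frestrictLe (π := fun _ : ℕ => L) k ⁻¹' U ∩ {ω | ω (k + 1) ∈ B} =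
      (fun ω : ℕ → L => (Preorder.frestrictLe (π := fun _ : ℕ => L) k ω, ω (k + 1))) ⁻¹'
        (U ×ˢ B) := by
    ext ω
    simp
  have h2 : C.measure (Preorder.frestrictLe (π := fun _ : ℕ => L) k ⁻¹' U ∩
      {ω | ω (k + 1) ∈ B}) =
      ∫⁻ ω in Preorder.frestrictLe (π := fun _ : ℕ => L) k ⁻¹' U,
        (C.P (ω k)).toMeasure B ∂C.measure := by
    rw [h1, ← Measure.map_apply (by fun_prop) (hU.prod hm)]
    unfold measure
    rw [← hmap, Measure.compProd_apply_prod hU hm, setLIntegral_map hU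
      (Kernel.measurable_coe _ hm) hfm]
    rfl
  rw [measureReal_def, h2, ← integral_toReal]
  · rfl
  · exact ((Measurable.of_discrete (f := fun l => (C.P l).toMeasure B)).comp
      (measurable_pi_apply k)).aemeasurable
  · refine Eventually.of_forall fun ω => ?_
    have : IsProbabilityMeasure (C.P (ω k)).toMeasure := PMF.toMeasure.isProbabilityMeasure _
    exact measure_lt_top _ _

theorem integrable_stepProb (C : MarkovChain L) (k : ℕ) (B : Set L) :
    Integrable (fun ω : ℕ → L => C.stepProb B (ω k)) C.measure :=
  Integrable.of_bound ((Measurable.of_discrete (f := C.stepProb B)).comp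
    (measurable_pi_apply k)).aestronglyMeasurable 1
    (Eventually.of_forall fun ω => by
      rw [Real.norm_eq_abs, abs_of_nonneg (C.stepProb_nonneg _ _)]; exact C.stepProb_le_one _ _)

theorem measureReal_succ_mem (C : MarkovChain L) (k : ℕ) (B : Set L) :
    C.measure.real {ω | ω (k + 1) ∈ B} = ∫ ω, C.stepProb B (ω k) ∂C.measure := by
  have := C.integral_next_indicator k B (H := Set.univ) MeasurableSet.univ
  simpa using this

theorem measurableSet_mem (k : ℕ) (B : Set L) :
    MeasurableSet {ω : ℕ → L | ω k ∈ B} :=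
  measurable_pi_apply k (MeasurableSet.of_discrete (s := B))

theorem condExp_next (C : MarkovChain L) (k : ℕ) (B : Set L) :
    C.measure[{ω : ℕ → L | ω (k + 1) ∈ B}.indicator (1 : (ℕ → L) → ℝ) | filtration L k]
      =ᵐ[C.measure] fun ω => C.stepProb B (ω k) := by
  symm
  have hB := measurableSet_mem (k + 1) B
  refine ae_eq_condExp_of_forall_setIntegral_eq ((filtration L).le k)
    ((integrable_const (1 : ℝ)).indicator hB) ?_ ?_ ?_
  · exact fun _ _ _ => (C.integrable_stepProb k B).integrableOn
  · intro H hH _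
    rw [← C.integral_next_indicator k B hH]
    rw [setIntegral_indicator hB]
    simp
  · exact ((Measurable.of_discrete (f := C.stepProb B)).comp
      (measurable_filtration le_rfl)).aestronglyMeasurable

/-- Strong law: visits to `B` and one-step probabilities of visiting `B` agree on average. -/
theorem ae_tendsto_average (C : MarkovChain L) (B : Set L) :
    ∀ᵐ ω ∂C.measure, Tendsto (fun T : ℕ =>
      (∑ k ∈ Finset.range T, (B.indicator (1 : L → ℝ) (ω (k + 1)) - C.stepProb B (ω k))) / T)
      atTop (𝓝 0) := by
  have hm : ∀ k, Measurable[filtration L (k + 1)] fun ω : ℕ → L =>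
      B.indicator (1 : L → ℝ) (ω (k + 1)) := fun k =>
    (Measurable.of_discrete (f := B.indicator (1 : L → ℝ))).comp (measurable_filtration le_rfl)
  have hm' : ∀ k, Measurable[filtration L (k + 1)] fun ω : ℕ → L => C.stepProb B (ω k) :=
    fun k => (Measurable.of_discrete (f := C.stepProb B)).comp (measurable_filtration k.le_succ)
  refine ae_tendsto_sum_martingaleDiff_div (ℱ := filtration L)
    (D := fun k ω => B.indicator (1 : L → ℝ) (ω (k + 1)) - C.stepProb B (ω k)) (c := 1)
    (fun k => ((hm k).sub (hm' k)).stronglyMeasurable) (fun k ω => ?_) fun k => ?_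
  · have h1 := C.stepProb_nonneg B (ω k)
    have h2 := C.stepProb_le_one B (ω k)
    by_cases h : ω (k + 1) ∈ B
    · rw [Set.indicator_of_mem h, abs_le]
      simp only [Pi.one_apply]
      constructor <;> linarith
    · rw [Set.indicator_of_notMem h, abs_le]
      constructor <;> linarith
  · have hB := measurableSet_mem (k + 1) B
    have hi : Integrable ({ω : ℕ → L | ω (k + 1) ∈ B}.indicator (1 : (ℕ → L) → ℝ)) C.measure :=
      (integrable_const (1 : ℝ)).indicator hB
    have h1 := condExp_sub hi (C.integrable_stepProb k B) (filtration L k)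
    have h2 : C.measure[fun ω => C.stepProb B (ω k) | filtration L k] =
        fun ω => C.stepProb B (ω k) :=
      condExp_of_stronglyMeasurable ((filtration L).le k)
        ((Measurable.of_discrete (f := C.stepProb B)).comp
          (measurable_filtration le_rfl)).stronglyMeasurable (C.integrable_stepProb k B)
    refine EventuallyEq.trans (Eventually.of_forall fun ω => rfl) (h1.trans ?_)
    filter_upwards [C.condExp_next k B] with ω hω
    simp [hω, h2]

/-- If steps from `B` into `B'` have probability at least `q > 0` and `B` is visited infinitely
often, then so is `B'` directly after `B`. -/
theorem ae_frequently_next (C : MarkovChain L) (B B' : Set L) (q : ℝ) (hq : 0 < q)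
    (h : ∀ l ∈ B, q ≤ C.stepProb B' l) :
    ∀ᵐ ω ∂C.measure, (∃ᶠ k in atTop, ω k ∈ B) → ∃ᶠ k in atTop, ω k ∈ B ∧ ω (k + 1) ∈ B' := by
  -- The index is shifted so that `s k` is known at time `k`. Truncated subtraction affects only `s
  -- 0`, which plays no role for the limit.
  set s : ℕ → Set (ℕ → L) := fun k => {ω | ω (k - 1) ∈ B ∧ ω k ∈ B'} with hs
  have hsm : ∀ k, MeasurableSet[filtration L k] (s k) := fun k =>
    (measurable_filtration (Nat.sub_le k 1) (MeasurableSet.of_discrete (s := B))).inter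
      (measurable_filtration le_rfl (MeasurableSet.of_discrete (s := B')))
  have hcond : ∀ k, C.measure[(s (k + 1)).indicator (1 : (ℕ → L) → ℝ) | filtration L k]
      =ᵐ[C.measure] fun ω => B.indicator (1 : L → ℝ) (ω k) * C.stepProb B' (ω k) := by
    intro k
    have e1 : (s (k + 1)).indicator (1 : (ℕ → L) → ℝ) =
        (fun ω => B.indicator (1 : L → ℝ) (ω k)) *
          {ω : ℕ → L | ω (k + 1) ∈ B'}.indicator (1 : (ℕ → L) → ℝ) := by
      ext ω
      by_cases h1 : ω k ∈ B <;> by_cases h2 : ω (k + 1) ∈ B' <;> simp [hs, h1, h2]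
    have hi : Integrable ({ω : ℕ → L | ω (k + 1) ∈ B'}.indicator (1 : (ℕ → L) → ℝ)) C.measure :=
      (integrable_const (1 : ℝ)).indicator (measurableSet_mem (k + 1) B')
    have hBm : StronglyMeasurable[filtration L k] fun ω : ℕ → L =>
        B.indicator (1 : L → ℝ) (ω k) :=
      ((Measurable.of_discrete (f := B.indicator (1 : L → ℝ))).comp
        (measurable_filtration le_rfl)).stronglyMeasurable
    rw [e1]
    have := condExp_mul_of_stronglyMeasurable_left (μ := C.measure) hBm
      (hi.bdd_mul (c := 1) (hBm.mono ((filtration L).le k)).aestronglyMeasurable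
        (Eventually.of_forall fun ω => by by_cases h1 : ω k ∈ B <;> simp [h1])) hi
    refine this.trans ?_
    filter_upwards [C.condExp_next k B'] with ω hω
    simp [hω]
  filter_upwards [ae_mem_limsup_atTop_iff C.measure hsm, ae_all_iff.2 hcond] with ω h1 h2 hB
  have h3 : Tendsto (fun n => ∑ k ∈ Finset.range n,
      (C.measure[(s (k + 1)).indicator (1 : (ℕ → L) → ℝ) | filtration L k]) ω) atTop atTop := by
    simp only [h2]
    -- By Lévy's Borel–Cantelli lemma it suffices that the conditional probabilities have infinite
    -- sum; infinitely many of them are at least `q`.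
    have h4 : ¬ Summable fun k => B.indicator (1 : L → ℝ) (ω k) * C.stepProb B' (ω k) := by
      intro hsum
      have h5 := hsum.tendsto_atTop_zero.eventually (gt_mem_nhds hq)
      obtain ⟨k, hk1, hk2⟩ := (hB.and_eventually h5).exists
      rw [Set.indicator_of_mem hk1, Pi.one_apply, one_mul] at hk2
      exact absurd (h _ hk1) (not_le.2 hk2)
    refine (not_summable_iff_tendsto_nat_atTop_of_nonneg fun k => ?_).1 h4
    exact mul_nonneg (Set.indicator_nonneg (fun _ _ => zero_le_one) _) (C.stepProb_nonneg _ _)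
  have h6 := h1.2 h3
  rw [mem_limsup_iff_frequently_mem] at h6
  rw [frequently_atTop] at h6 ⊢
  intro a
  obtain ⟨b, hb, hb1, hb2⟩ := h6 (a + 1)
  refine ⟨b - 1, by omega, hb1, ?_⟩
  rwa [Nat.sub_add_cancel (by omega)]

theorem measure_zero_eq (C : MarkovChain L) [Countable L] (l : L) :
    C.measure {ω | ω 0 = l} = C.μ l := by
  have := C.measure_cone (fun _ => l) 0
  simpa using this

theorem ae_zero (C : MarkovChain L) [Countable L] {Q : L → Prop} (h : ∀ l, C.μ l ≠ 0 → Q l) :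
    ∀ᵐ ω ∂C.measure, Q (ω 0) := by
  have h1 : ∀ᵐ ω ∂C.measure, ∀ l, ¬ Q l → ω 0 ≠ l := by
    rw [ae_all_iff]
    intro l
    by_cases hl : Q l
    · simp [hl]
    · have : C.measure {ω | ω 0 = l} = 0 := by
        rw [measure_zero_eq]
        by_contra hne
        exact hl (h l hne)
      simpa [hl, ae_iff] using this
  filter_upwards [h1] with ω hω
  by_contra hcon
  exact hω _ hcon rfl

/-- Reduces almost sure statements about consecutive locations to a check on the support of the
transition function; countability allows a union over the current location. -/
theorem ae_succ (C : MarkovChain L) [Countable L] {R : L → L → Prop}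
    (h : ∀ l l', C.P l l' ≠ 0 → R l l') :
    ∀ᵐ ω ∂C.measure, ∀ t, R (ω t) (ω (t + 1)) := by
  rw [ae_all_iff]
  intro t
  have h1 : ∀ᵐ ω ∂C.measure, ∀ l, ω t = l → R l (ω (t + 1)) := by
    rw [ae_all_iff]
    intro l
    have h2 := C.integral_next_indicator t {l' | ¬ R l l'} (H := {ω | ω t ∈ ({l} : Set L)})
      (measurable_filtration le_rfl MeasurableSet.of_discrete)
    have h3 : C.stepProb {l' | ¬ R l l'} l = 0 := by
      rw [stepProb, ENNReal.toReal_eq_zero_iff]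
      left
      rw [PMF.toMeasure_apply_eq_zero_iff _ MeasurableSet.of_discrete, Set.disjoint_left]
      exact fun l' hl' hR => hR (h l l' hl')
    have h4 : ∀ ω ∈ {ω : ℕ → L | ω t ∈ ({l} : Set L)},
        C.stepProb {l' | ¬ R l l'} (ω t) = 0 := fun ω (hω : ω t = l) => by rw [hω, h3]
    rw [setIntegral_eq_zero_of_forall_eq_zero h4, measureReal_eq_zero_iff] at h2
    rw [ae_iff]
    convert h2 using 2
    ext ω
    simp
  filter_upwards [h1] with ω hω
  exact hω _ rfl

end MarkovChain

/-! ### Invariant distributions, normalization of weights, and finitely generated cones -/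

section Elementary

/-- A stochastic matrix has an invariant distribution. -/
theorem exists_invariant_of_stochastic {ι : Type*} [Fintype ι] [Nonempty ι] (P : Matrix ι ι ℝ)
    (h0 : ∀ i j, 0 ≤ P i j) (h1 : ∀ i, ∑ j, P i j = 1) :
    ∃ v : ι → ℝ, (∀ i, 0 ≤ v i) ∧ ∑ i, v i = 1 ∧ ∀ j, ∑ i, v i * P i j = v j := by
  classical
  -- Rows sum to `1`, so `P - 1` kills the constant vector; being singular, it also has a left null
  -- vector.
  have hdet : (P - 1).det = 0 := by
    refine Matrix.exists_mulVec_eq_zero_iff.1 ⟨fun _ => 1, ?_, ?_⟩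
    · intro h
      simpa using congrFun h (Classical.arbitrary ι)
    · ext i
      simp [Matrix.mulVec, dotProduct, Matrix.sub_apply, Finset.sum_sub_distrib, h1,
        Matrix.one_apply]
  obtain ⟨v, hv0, hv⟩ := Matrix.exists_vecMul_eq_zero_iff.2 hdet
  have hv' : ∀ j, ∑ i, v i * P i j = v j := by
    intro j
    have := congrFun hv j
    simp only [Matrix.vecMul_sub, Matrix.vecMul_one, Pi.sub_apply, Pi.zero_apply, sub_eq_zero] at this
    exact this
  -- The absolute values of an invariant vector are subinvariant; since `P` preserves total mass,
  -- equality holds everywhere.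
  have hle : ∀ j, |v j| ≤ ∑ i, |v i| * P i j := by
    intro j
    conv_lhs => rw [← hv' j]
    refine (Finset.abs_sum_le_sum_abs _ _).trans (le_of_eq (Finset.sum_congr rfl fun i _ => ?_))
    rw [abs_mul, abs_of_nonneg (h0 i j)]
  have hsum : ∑ j, ∑ i, |v i| * P i j = ∑ j, |v j| := by
    rw [Finset.sum_comm]
    simp_rw [← Finset.mul_sum, h1, mul_one]
  have heq : ∀ j, |v j| = ∑ i, |v i| * P i j := fun j =>
    (Finset.sum_eq_sum_iff_of_le fun j _ => hle j).1 hsum.symm j (Finset.mem_univ j)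
  have hpos : 0 < ∑ j, |v j| := by
    obtain ⟨j, hj⟩ := Function.ne_iff.1 hv0
    exact Finset.sum_pos' (fun _ _ => abs_nonneg _) ⟨j, Finset.mem_univ j, abs_pos.2 hj⟩
  refine ⟨fun i => |v i| / ∑ j, |v j|, fun i => by positivity, ?_, fun j => ?_⟩
  · rw [← Finset.sum_div, div_self hpos.ne']
  · simp_rw [div_mul_eq_mul_div]
    rw [← Finset.sum_div, ← heq]

/-- Nonnegative weights are multiples of a distribution. -/
theorem exists_pmf_of_weights {α : Type*} [Fintype α] (f : α → ℝ) (hf : ∀ a, 0 ≤ f a)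
    (T : Set α) (hT : T.Nonempty) (hfT : ∀ a, f a ≠ 0 → a ∈ T) :
    ∃ p : PMF α, (∀ a, p a ≠ 0 → a ∈ T) ∧ ∀ a, f a = (∑ b, f b) * (p a).toReal := by
  rcases (Finset.sum_nonneg fun a _ => hf a : 0 ≤ ∑ b, f b).eq_or_lt with h | h
  · obtain ⟨t, ht⟩ := hT
    refine ⟨PMF.pure t, fun a ha => ?_, fun a => ?_⟩
    · have : a = t := by simpa using ha
      rwa [this]
    · rw [← h, zero_mul]
      exact (Finset.sum_eq_zero_iff_of_nonneg fun a _ => hf a).1 h.symm a (Finset.mem_univ a)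
  · refine ⟨PMF.ofFintype (fun a => ENNReal.ofReal (f a / ∑ b, f b)) ?_, fun a ha => ?_,
      fun a => ?_⟩
    · rw [← ENNReal.ofReal_sum_of_nonneg fun a _ => div_nonneg (hf a) h.le, ← Finset.sum_div,
        div_self h.ne', ENNReal.ofReal_one]
    · refine hfT a fun h0 => ha ?_
      simp [h0]
    · rw [PMF.ofFintype_apply, ENNReal.toReal_ofReal (div_nonneg (hf a) h.le),
        mul_div_cancel₀ _ h.ne']

/-- Conic Carathéodory: a nonnegative combination can be taken over a linearly independent
subfamily. -/
theorem exists_linearIndepOn_nonneg_combination {ι E : Type*} [Fintype ι] [AddCommGroup E]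
    [Module ℝ E] (v : ι → E) (y : ι → ℝ) (hy : ∀ i, 0 ≤ y i) :
    ∃ (I : Finset ι) (z : ι → ℝ), LinearIndepOn ℝ v (I : Set ι) ∧ (∀ i, 0 ≤ z i) ∧
      ∑ i ∈ I, z i • v i = ∑ i, y i • v i := by
  classical
  have key : ∃ I : Finset ι, ∃ z : ι → ℝ, (∀ i, 0 ≤ z i) ∧ ∑ i ∈ I, z i • v i = ∑ i, y i • v i :=
    ⟨Finset.univ, y, hy, rfl⟩
  -- A support of minimal size is independent: a linear relation could be used to remove one more
  -- vector.
  obtain ⟨I, hI, hmin⟩ := WellFounded.has_min (r := fun I J : Finset ι => I.card < J.card)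
    (InvImage.wf Finset.card wellFounded_lt)
    {I | ∃ z : ι → ℝ, (∀ i, 0 ≤ z i) ∧ ∑ i ∈ I, z i • v i = ∑ i, y i • v i} key
  obtain ⟨z, hz, hsum⟩ := hI
  refine ⟨I, z, ?_, hz, hsum⟩
  by_contra hdep
  rw [linearIndepOn_finset_iff] at hdep
  push Not at hdep
  obtain ⟨g, hg, i, hi, hgi⟩ := hdep
  wlog hpos : 0 < g i generalizing g
  · exact this (fun i => - g i) (by simp [hg]) (by simpa using hgi)
      (by simpa using lt_of_le_of_ne (not_lt.1 hpos) hgi)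
  -- The smallest ratio is the largest multiple of `g` that can be subtracted with all coefficients
  -- staying nonnegative; coefficient `j` becomes zero.
  obtain ⟨j, hj, hjmin⟩ := Finset.exists_min_image (I.filter fun k => 0 < g k)
    (fun k => z k / g k) ⟨i, by simp [hi, hpos]⟩
  rw [Finset.mem_filter] at hj
  set t := z j / g j
  have ht : 0 ≤ t := div_nonneg (hz j) hj.2.le
  refine hmin (I.erase j) ⟨fun k => if k ∈ I then z k - t * g k else 0, fun k => ?_, ?_⟩
    (Finset.card_erase_lt_of_mem hj.1)
  · dsimp only
    split_ifs with hk
    · rcases lt_or_ge 0 (g k) with h | h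
      · have := hjmin k (Finset.mem_filter.2 ⟨hk, h⟩)
        rw [le_div_iff₀ h] at this
        linarith
      · nlinarith [hz k]
    · exact le_rfl
  · have h0 : (z j - t * g j) • v j = 0 := by
      rw [div_mul_cancel₀ _ hj.2.ne', sub_self, zero_smul]
    calc ∑ k ∈ I.erase j, (if k ∈ I then z k - t * g k else 0) • v k
        = ∑ k ∈ I.erase j, (z k - t * g k) • v k := Finset.sum_congr rfl fun k hk => by
          rw [if_pos (Finset.mem_of_mem_erase hk)]
      _ = ∑ k ∈ I, (z k - t * g k) • v k := by
          rw [← Finset.add_sum_erase I _ hj.1, h0, zero_add]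
      _ = ∑ k ∈ I, z k • v k - t • ∑ k ∈ I, g k • v k := by
          rw [Finset.smul_sum, ← Finset.sum_sub_distrib]
          simp_rw [sub_smul, mul_smul]
      _ = _ := by rw [hg, smul_zero, sub_zero, hsum]

/-- Finitely generated cones are closed. -/
theorem isClosed_nonneg_combinations {ι E : Type*} [Fintype ι] [NormedAddCommGroup E]
    [NormedSpace ℝ E] (v : ι → E) :
    IsClosed {x | ∃ y : ι → ℝ, (∀ i, 0 ≤ y i) ∧ ∑ i, y i • v i = x} := by
  classical
  -- By Carathéodory the cone is a finite union of images of orthants under injective linear maps,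
  -- and these maps are closed embeddings.
  have hU : {x | ∃ y : ι → ℝ, (∀ i, 0 ≤ y i) ∧ ∑ i, y i • v i = x} =
      ⋃ I ∈ {I : Finset ι | LinearIndepOn ℝ v (I : Set ι)},
        (Fintype.linearCombination ℝ fun i : I => v i) '' {z | ∀ i, 0 ≤ z i} := by
    ext x
    simp only [Set.mem_ofPred_eq, Set.mem_iUnion, Set.mem_image, exists_prop]
    constructor
    · rintro ⟨y, hy, rfl⟩
      obtain ⟨I, z, hI, hz, hsum⟩ := exists_linearIndepOn_nonneg_combination v y hy
      refine ⟨I, hI, fun i => z i, fun i => hz i, ?_⟩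
      rw [← hsum, Fintype.linearCombination_apply, ← Finset.sum_coe_sort I]
    · rintro ⟨I, -, z, hz, rfl⟩
      refine ⟨fun i => if h : i ∈ I then z ⟨i, h⟩ else 0, fun i => ?_, ?_⟩
      · dsimp only
        split_ifs
        · exact hz _
        · exact le_rfl
      · rw [Fintype.linearCombination_apply]
        have h1 : ∑ i, (if h : i ∈ I then z ⟨i, h⟩ else 0) • v i =
            ∑ i ∈ I, (if h : i ∈ I then z ⟨i, h⟩ else 0) • v i := by
          symm
          refine Finset.sum_subset (Finset.subset_univ I) fun i _ hi => ?_
          rw [dif_neg hi, zero_smul]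
        rw [h1, ← Finset.sum_coe_sort I]
        exact Finset.sum_congr rfl fun i _ => by rw [dif_pos i.2]
  rw [hU]
  refine Set.Finite.isClosed_biUnion (Set.toFinite _) fun I hI => ?_
  have hinj : LinearMap.ker (Fintype.linearCombination ℝ fun i : I => v i) = ⊥ := by
    rw [LinearMap.ker_eq_bot']
    intro z hz
    rw [Fintype.linearCombination_apply] at hz
    exact funext (Fintype.linearIndependent_iff.1 hI z hz)
  refine (LinearMap.isClosedEmbedding_of_injective hinj).isClosedMap _ ?_
  exact isClosed_Ici (a := (0 : I → ℝ))

end Elementary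

/-! ### Flows, end components and their circulations -/

namespace MDP

open scoped Classical

variable {S A : Type*} [Fintype S] [Fintype A] (G : MDP S A)

/-- The state in which an action is enabled. -/
noncomputable def src (a : A) : S := (G.act_partition a).choose

theorem mem_Act_iff {a : A} {s : S} : a ∈ G.Act s ↔ G.src a = s :=
  ⟨fun h => ((G.act_partition a).choose_spec.2 s h).symm,
    fun h => h ▸ (G.act_partition a).choose_spec.1⟩

/-- Transition probabilities as real numbers. -/
noncomputable def prob (a : A) (s : S) : ℝ := (G.δ a s).toReal

theorem prob_nonneg (a : A) (s : S) : 0 ≤ G.prob a s := ENNReal.toReal_nonneg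

theorem prob_pos_iff {a : A} {s : S} : 0 < G.prob a s ↔ G.δ a s ≠ 0 := by
  rw [prob, ENNReal.toReal_pos_iff, pos_iff_ne_zero]
  exact and_iff_left ((G.δ a).apply_lt_top s)

theorem prob_eq_zero_iff {a : A} {s : S} : G.prob a s = 0 ↔ G.δ a s = 0 := by
  rw [prob, ENNReal.toReal_eq_zero_iff]
  exact or_iff_left ((G.δ a).apply_ne_top s)

theorem sum_toReal_pmf {α : Type*} [Fintype α] (p : PMF α) : ∑ a, (p a).toReal = 1 := by
  rw [← ENNReal.toReal_sum fun a _ => p.apply_ne_top a, ← tsum_fintype (L := .unconditional α),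
    p.tsum_coe, ENNReal.toReal_one]

theorem sum_prob (a : A) : ∑ s, G.prob a s = 1 := sum_toReal_pmf _

/-- The flow `x` out of a state. -/
noncomputable def outflow (x : A → ℝ) (s : S) : ℝ := ∑ a, if G.src a = s then x a else 0

/-- The flow `x` into a state. -/
noncomputable def inflow (x : A → ℝ) (s : S) : ℝ := ∑ a, x a * G.prob a s

theorem sum_outflow (x : A → ℝ) : ∑ s, G.outflow x s = ∑ a, x a := by
  unfold outflow
  rw [Finset.sum_comm]
  simp

theorem sum_inflow (x : A → ℝ) : ∑ s, G.inflow x s = ∑ a, x a := by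
  unfold inflow
  rw [Finset.sum_comm]
  simp [← Finset.mul_sum, sum_prob]

theorem outflow_nonneg {x : A → ℝ} (h : ∀ a, 0 ≤ x a) (s : S) : 0 ≤ G.outflow x s :=
  Finset.sum_nonneg fun a _ => by split_ifs <;> simp [h]

theorem inflow_nonneg {x : A → ℝ} (h : ∀ a, 0 ≤ x a) (s : S) : 0 ≤ G.inflow x s :=
  Finset.sum_nonneg fun a _ => mul_nonneg (h a) (G.prob_nonneg a s)

theorem outflow_add (x y : A → ℝ) (s : S) :
    G.outflow (fun a => x a + y a) s = G.outflow x s + G.outflow y s := by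
  simp only [outflow, ← Finset.sum_add_distrib]
  exact Finset.sum_congr rfl fun a _ => by split_ifs <;> simp

theorem inflow_add (x y : A → ℝ) (s : S) :
    G.inflow (fun a => x a + y a) s = G.inflow x s + G.inflow y s := by
  simp only [inflow, ← Finset.sum_add_distrib, add_mul]

theorem outflow_smul (c : ℝ) (x : A → ℝ) (s : S) :
    G.outflow (fun a => c * x a) s = c * G.outflow x s := by
  simp only [outflow, Finset.mul_sum, mul_ite, mul_zero]

theorem inflow_smul (c : ℝ) (x : A → ℝ) (s : S) :
    G.inflow (fun a => c * x a) s = c * G.inflow x s := by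
  simp only [inflow, Finset.mul_sum, mul_assoc]

theorem outflow_sum {ι : Type*} (I : Finset ι) (x : ι → A → ℝ) (s : S) :
    G.outflow (fun a => ∑ i ∈ I, x i a) s = ∑ i ∈ I, G.outflow (x i) s := by
  simp only [outflow]
  rw [Finset.sum_comm]
  exact Finset.sum_congr rfl fun a _ => by split_ifs <;> simp

theorem inflow_sum {ι : Type*} (I : Finset ι) (x : ι → A → ℝ) (s : S) :
    G.inflow (fun a => ∑ i ∈ I, x i a) s = ∑ i ∈ I, G.inflow (x i) s := by
  simp only [inflow, Finset.sum_mul]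
  rw [Finset.sum_comm]

/-- Flow conservation in every state. -/
def IsCirculation (x : A → ℝ) : Prop := ∀ s, G.inflow x s = G.outflow x s

/-- One step from action `a` to an action `a'` in `B`. -/
def Step (B : Set A) (a a' : A) : Prop := a' ∈ B ∧ G.δ a (G.src a') ≠ 0

/-- End components, given by their sets of actions. -/
structure IsEndComponent (B : Set A) : Prop where
  nonempty : B.Nonempty
  closed : ∀ a ∈ B, ∀ s, G.δ a s ≠ 0 → ∃ a' ∈ B, G.src a' = s
  connected : ∀ a ∈ B, ∀ a' ∈ B, Relation.TransGen (G.Step B) a a'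

variable {G}

/-- A step requires only that the source of the next action be reachable, so a path ending in an
action can be redirected to any other action at the same state. A shared state therefore joins the
two components. -/
theorem IsEndComponent.union {B₁ B₂ : Set A} (h₁ : G.IsEndComponent B₁) (h₂ : G.IsEndComponent B₂)
    {a₁ a₂ : A} (ha₁ : a₁ ∈ B₁) (ha₂ : a₂ ∈ B₂) (h : G.src a₁ = G.src a₂) :
    G.IsEndComponent (B₁ ∪ B₂) := by
  have mono₁ : ∀ a a', Relation.TransGen (G.Step B₁) a a' →
      Relation.TransGen (G.Step (B₁ ∪ B₂)) a a' := fun a a' =>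
    Relation.TransGen.mono (fun _ _ h => ⟨Or.inl h.1, h.2⟩) a a'
  have mono₂ : ∀ a a', Relation.TransGen (G.Step B₂) a a' →
      Relation.TransGen (G.Step (B₁ ∪ B₂)) a a' := fun a a' =>
    Relation.TransGen.mono (fun _ _ h => ⟨Or.inr h.1, h.2⟩) a a'
  have swap : ∀ {a b b'}, b' ∈ B₁ ∪ B₂ → G.src b = G.src b' →
      Relation.TransGen (G.Step (B₁ ∪ B₂)) a b →
      Relation.TransGen (G.Step (B₁ ∪ B₂)) a b' := by
    intro a b b' hb' hbb' hab
    obtain ⟨c, hac, hcb⟩ := Relation.TransGen.tail'_iff.1 hab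
    exact Relation.TransGen.tail'_iff.2 ⟨c, hac, hb', hbb' ▸ hcb.2⟩
  refine ⟨h₁.nonempty.mono Set.subset_union_left, ?_, ?_⟩
  · rintro a (ha | ha) s hs
    · obtain ⟨a', h', e⟩ := h₁.closed a ha s hs
      exact ⟨a', Or.inl h', e⟩
    · obtain ⟨a', h', e⟩ := h₂.closed a ha s hs
      exact ⟨a', Or.inr h', e⟩
  · rintro a (ha | ha) a' (ha' | ha')
    · exact mono₁ _ _ (h₁.connected a ha a' ha')
    · exact (swap (Or.inr ha₂) h (mono₁ _ _ (h₁.connected a ha a₁ ha₁))).trans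
        (mono₂ _ _ (h₂.connected a₂ ha₂ a' ha'))
    · exact (swap (Or.inl ha₁) h.symm (mono₂ _ _ (h₂.connected a ha a₂ ha₂))).trans
        (mono₁ _ _ (h₁.connected a₁ ha₁ a' ha'))
    · exact mono₂ _ _ (h₂.connected a ha a' ha')

variable (G) in
/-- Maximal end components. -/
def MEC : Type _ := {C : Set A // Maximal G.IsEndComponent C}

noncomputable instance : Fintype G.MEC := by
  unfold MEC
  exact Fintype.ofFinite _

theorem MEC.isEndComponent (C : G.MEC) : G.IsEndComponent C.1 := C.2.prop

theorem IsEndComponent.exists_mec {B : Set A} (h : G.IsEndComponent B) : ∃ C : G.MEC, B ⊆ C.1 := by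
  obtain ⟨C, hBC, hC⟩ := (Set.toFinite {B | G.IsEndComponent B}).exists_le_maximal h
  exact ⟨⟨C, hC⟩, hBC⟩

/-- The union of two maximal end components sharing a state is an end component, so maximality
identifies them. -/
theorem MEC.eq_of_src {C₁ C₂ : G.MEC} {a₁ a₂ : A} (h₁ : a₁ ∈ C₁.1) (h₂ : a₂ ∈ C₂.1)
    (h : G.src a₁ = G.src a₂) : C₁ = C₂ := by
  have hu := C₁.isEndComponent.union C₂.isEndComponent h₁ h₂ h
  refine Subtype.ext (Set.Subset.antisymm ?_ ?_)
  · exact Set.subset_union_left.trans (C₂.2.le_of_ge hu Set.subset_union_right)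
  · exact Set.subset_union_right.trans (C₁.2.le_of_ge hu Set.subset_union_left)

/-- Every end component carries a circulation with full support. -/
theorem IsEndComponent.exists_circulation {B : Set A} (h : G.IsEndComponent B) :
    ∃ z : A → ℝ, (∀ a, 0 ≤ z a) ∧ (∀ a, 0 < z a ↔ a ∈ B) ∧ ∑ a, z a = 1 ∧
      G.IsCirculation z := by
  -- `N s` counts the actions of `B` at `s`. The circulation is the invariant distribution of the
  -- chain on `B` that chooses uniformly among them.
  set N : S → ℝ := fun s => ∑ a, if a ∈ B ∧ G.src a = s then 1 else 0 with hN
  have hN0 : ∀ a ∈ B, 0 < N (G.src a) := fun a ha =>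
    Finset.sum_pos' (fun _ _ => by split_ifs <;> simp) ⟨a, Finset.mem_univ a, by simp [ha]⟩
  have hNs : ∀ a ∈ B, ∀ s, G.prob a s ≠ 0 → N s ≠ 0 := by
    intro a ha s hs
    obtain ⟨a', ha', rfl⟩ := h.closed a ha s (by rwa [Ne, ← prob_eq_zero_iff])
    exact (hN0 a' ha').ne'
  have : Nonempty B := h.nonempty.to_subtype
  have hsub : ∀ (f : A → ℝ), ∑ a : B, f a = ∑ a, if a ∈ B then f a else 0 := by
    intro f
    rw [← Finset.sum_filter]
    exact (Finset.sum_subtype _ (by simp) _).symm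
  obtain ⟨v, hv0, hv1, hv⟩ := exists_invariant_of_stochastic
    (fun a a' : B => G.prob a (G.src a') / N (G.src a'))
    (fun a a' => div_nonneg (G.prob_nonneg _ _) (hN0 a' a'.2).le) (by
      intro a
      rw [hsub fun a' => G.prob a (G.src a') / N (G.src a')]
      have : ∀ a', (if a' ∈ B then G.prob a (G.src a') / N (G.src a') else 0) =
          ∑ s, (G.prob a s / N s) * if a' ∈ B ∧ G.src a' = s then 1 else 0 := by
        intro a'
        by_cases ha' : a' ∈ B <;> simp [ha']
      simp_rw [this]
      rw [Finset.sum_comm]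
      simp_rw [← Finset.mul_sum]
      conv_rhs => rw [← G.sum_prob a]
      refine Finset.sum_congr rfl fun s _ => ?_
      by_cases hs : G.prob a s = 0
      · simp [hs]
      · exact div_mul_cancel₀ _ (hNs a a.2 s hs))
  set z : A → ℝ := fun a => if ha : a ∈ B then v ⟨a, ha⟩ else 0 with hz
  have hzB : ∀ a : B, z a = v a := fun a => by simp [hz]
  have hzn : ∀ a, a ∉ B → z a = 0 := fun a ha => by simp [hz, ha]
  have hz0 : ∀ a, 0 ≤ z a := fun a => by
    by_cases ha : a ∈ B
    · exact (hzB ⟨a, ha⟩).symm ▸ hv0 _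
    · exact (hzn a ha).ge
  have hsum : ∀ f : A → ℝ, ∑ a : B, v a * f a = ∑ a, z a * f a := by
    intro f
    calc ∑ a : B, v a * f a = ∑ a : B, z a * f a := by simp_rw [hzB]
      _ = _ := by
        rw [hsub fun a => z a * f a]
        exact Finset.sum_congr rfl fun a _ => by
          by_cases ha : a ∈ B <;> simp [ha, hzn]
  have hzeq : ∀ a ∈ B, G.inflow z (G.src a) = N (G.src a) * z a := by
    intro a ha
    have h1 := hv ⟨a, ha⟩
    rw [← hzB ⟨a, ha⟩] at h1
    have h2 := hsum fun a' => G.prob a' (G.src a) / N (G.src a)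
    rw [h2] at h1
    simp_rw [← mul_div_assoc] at h1
    rw [← Finset.sum_div, div_eq_iff (hN0 a ha).ne', mul_comm] at h1
    exact h1
  have hstep : ∀ a a', 0 < z a → G.Step B a a' → 0 < z a' := by
    intro a a' ha haa'
    have h1 : 0 < G.inflow z (G.src a') :=
      Finset.sum_pos' (fun _ _ => mul_nonneg (hz0 _) (G.prob_nonneg _ _))
        ⟨a, Finset.mem_univ a, mul_pos ha (G.prob_pos_iff.2 haa'.2)⟩
    rw [hzeq a' haa'.1] at h1
    exact (mul_pos_iff_of_pos_left (hN0 a' haa'.1)).1 h1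
  have hz1 : ∑ a, z a = 1 := by
    have := hsum fun _ => 1
    simp only [mul_one] at this
    rw [← this, hv1]
  refine ⟨z, hz0, fun a => ⟨fun ha => ?_, fun ha => ?_⟩, hz1, fun s => ?_⟩
  · by_contra hB
    exact ha.ne' (hzn a hB)
  · obtain ⟨b, hb⟩ : ∃ b, 0 < z b := by
      by_contra! hcon
      have : ∑ a, z a ≤ 0 := Finset.sum_nonpos fun a _ => hcon a
      linarith
    have hbB : b ∈ B := by
      by_contra hB
      exact hb.ne' (hzn b hB)
    -- Some action has positive weight, and positivity spreads along steps, hence over all of `B`.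
    have := h.connected b hbB a ha
    clear ha
    induction this with
    | single h => exact hstep _ _ hb h
    | tail _ h ih => exact hstep _ _ ih h
  · by_cases hs : ∃ a ∈ B, G.src a = s
    · obtain ⟨a₀, ha₀, rfl⟩ := hs
      set s := G.src a₀
      have h1 : G.outflow z s = ∑ a, (G.inflow z s / N s) *
          if a ∈ B ∧ G.src a = s then 1 else 0 := by
        refine Finset.sum_congr rfl fun a _ => ?_
        by_cases hs : G.src a = s
        · by_cases ha : a ∈ B
          · rw [← hs, hzeq a ha]
            simp [ha, (hN0 a ha).ne']
          · simp [hs, ha, hzn]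
        · simp [hs]
      rw [h1, ← Finset.mul_sum, div_mul_cancel₀ _ (hN0 a₀ ha₀).ne']
    · push Not at hs
      have h1 : G.outflow z s = 0 := Finset.sum_eq_zero fun a _ => by
        split_ifs with h1
        · exact hzn a fun ha => hs a ha h1
        · rfl
      have h2 : G.inflow z s = 0 := Finset.sum_eq_zero fun a _ => by
        by_cases ha : a ∈ B
        · by_cases h3 : G.δ a s = 0
          · rw [G.prob_eq_zero_iff.2 h3, mul_zero]
          · obtain ⟨a', ha', e⟩ := h.closed a ha s h3
            exact absurd e (hs a' ha')
        · rw [hzn a ha, zero_mul]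
      rw [h1, h2]

/-- Invariant distributions of a randomized memoryless choice `u` are unique on an end
component. -/
theorem IsEndComponent.invariant_unique {B : Set A} (h : G.IsEndComponent B) {u μ π : A → ℝ}
    (hπ : ∀ a ∈ B, 0 < π a) (hπ0 : ∀ a, a ∉ B → π a = 0)
    (hμ0 : ∀ a, a ∉ B → μ a = 0) (hπu : ∀ a, π a = G.inflow π (G.src a) * u a)
    (hμu : ∀ a, μ a = G.inflow μ (G.src a) * u a) (hπ1 : ∑ a, π a = 1) (hμ1 : ∑ a, μ a = 1) :
    μ = π := by
  -- With `c` the least ratio, `μ - c π` is invariant and nonnegative and vanishes at `a₀`. Its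
  -- zeros propagate backwards along steps, so it is zero everywhere, and comparing totals gives `c
  -- = 1`.
  obtain ⟨a₀, ha₀, hmin⟩ := Finset.exists_min_image (Finset.univ.filter (· ∈ B))
    (fun a => μ a / π a) (by obtain ⟨b, hb⟩ := h.nonempty; exact ⟨b, by simp [hb]⟩)
  simp only [Finset.mem_filter, Finset.mem_univ, true_and] at ha₀ hmin
  set c := μ a₀ / π a₀
  set d : A → ℝ := fun a => μ a + (-c) * π a with hd
  have hd0 : ∀ a, 0 ≤ d a := by
    intro a
    by_cases ha : a ∈ B
    · have := hmin a ha
      rw [le_div_iff₀ (hπ a ha)] at this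
      simp only [hd]
      linarith
    · simp [hd, hπ0 a ha, hμ0 a ha]
  have hda₀ : d a₀ = 0 := by
    simp only [hd, c]
    field_simp [(hπ a₀ ha₀).ne']
    ring
  have hdu : ∀ a, d a = G.inflow d (G.src a) * u a := by
    intro a
    simp only [hd]
    rw [inflow_add, inflow_smul, add_mul, ← hμu, mul_assoc, ← hπu]
  have hu : ∀ a ∈ B, u a ≠ 0 := by
    intro a ha h0
    have := hπ a ha
    rw [hπu, h0, mul_zero] at this
    exact lt_irrefl _ this
  have hback : ∀ a a', d a' = 0 → G.Step B a a' → d a = 0 := by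
    intro a a' ha' haa'
    rw [hdu, mul_eq_zero, or_iff_left (hu a' haa'.1)] at ha'
    have := (Finset.sum_eq_zero_iff_of_nonneg fun b _ =>
      mul_nonneg (hd0 b) (G.prob_nonneg b _)).1 ha' a (Finset.mem_univ a)
    exact (mul_eq_zero.1 this).resolve_right (G.prob_pos_iff.2 haa'.2).ne'
  have hdz : ∀ a, d a = 0 := by
    intro a
    by_cases ha : a ∈ B
    · have := h.connected a ha a₀ ha₀
      induction this using Relation.TransGen.head_induction_on with
      | single h => exact hback _ _ hda₀ h
      | head h _ ih => exact hback _ _ (ih h.1) h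
    · simp [hd, hπ0 a ha, hμ0 a ha]
  have hc : c = 1 := by
    have h1 : ∑ a, d a = 0 := Finset.sum_eq_zero fun a _ => hdz a
    simp only [hd, Finset.sum_add_distrib, ← Finset.mul_sum, hπ1, hμ1] at h1
    linarith
  ext a
  have := hdz a
  simp only [hd, hc] at this
  linarith

end MDP

/-! ### Runs settle in a maximal end component -/

namespace Strategy

open scoped Classical

variable {S A : Type*} [Fintype S] [Fintype A] {G : MDP S A} {M : Type*} (σ : Strategy G M)

/-- Memory update and next move are drawn after the successor state, so they do not affect its law.
-/
theorem stepProb_state (l : Loc S M A) (s : S) :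
    σ.play.stepProb {l' | l'.state = s} l = G.prob l.act s := by
  have h1 : (σ.play.P l).map Loc.state = G.δ l.act := by
    simp only [play, PMF.map_bind, PMF.map_comp]
    have : ∀ s' m', (Loc.state ∘ fun a' : A => (⟨s', m', a'⟩ : Loc S M A)) = Function.const A s' :=
      fun _ _ => rfl
    simp only [this, PMF.map_const, PMF.bind_const, PMF.bind_pure]
  let : MeasurableSpace S := ⊤
  have : DiscreteMeasurableSpace S := ⟨fun _ => trivial⟩
  have h2 := PMF.toMeasure_map_apply Loc.state (σ.play.P l) {s}
    Measurable.of_discrete (MeasurableSet.of_discrete)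
  rw [h1, PMF.toMeasure_apply_singleton _ _ MeasurableSet.of_discrete] at h2
  rw [MarkovChain.stepProb, MDP.prob, h2]
  rfl

theorem stepProb_loc (l : Loc S M A) (s : S) (m : M) (a : A) :
    σ.play.stepProb {⟨s, m, a⟩} l =
      G.prob l.act s * (σ.upd l.act s l.mem m).toReal * (σ.next s m a).toReal := by
  rw [MarkovChain.stepProb_singleton, play_P_apply, ENNReal.toReal_mul, ENNReal.toReal_mul]
  rfl

variable [Countable M]

theorem ae_src_act : ∀ᵐ ω ∂σ.runMeasure, ∀ t, G.src (ω t).act = (ω t).state := by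
  have h1 := σ.play.ae_zero (Q := fun l => G.src l.act = l.state) fun ⟨s, m, a⟩ hl => by
    rw [play_μ_apply] at hl
    exact G.mem_Act_iff.1 (σ.next_enabled s m a (right_ne_zero_of_mul hl))
  have h2 := σ.play.ae_succ (R := fun _ l => G.src l.act = l.state) fun _ ⟨s, m, a⟩ hl => by
    rw [play_P_apply] at hl
    exact G.mem_Act_iff.1 (σ.next_enabled s m a (right_ne_zero_of_mul hl))
  filter_upwards [h1, h2] with ω h1 h2 t
  cases t with
  | zero => exact h1
  | succ t => exact h2 t

theorem ae_step : ∀ᵐ ω ∂σ.runMeasure, ∀ t, G.δ (ω t).act (ω (t + 1)).state ≠ 0 :=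
  σ.play.ae_succ (R := fun l l' => G.δ l.act l'.state ≠ 0) fun l ⟨s, m, a⟩ hl => by
    rw [play_P_apply] at hl
    exact left_ne_zero_of_mul (left_ne_zero_of_mul hl)

theorem ae_state_zero : ∀ᵐ ω ∂σ.runMeasure, (ω 0).state = G.s₀ :=
  σ.play.ae_zero (Q := fun l => l.state = G.s₀) fun ⟨s, m, a⟩ hl => by
    rw [play_μ_apply] at hl
    by_contra hs
    exact left_ne_zero_of_mul (left_ne_zero_of_mul hl) (if_neg hs)

/-- Almost every run is eventually confined to a maximal end component. -/
theorem ae_exists_mec : ∀ᵐ ω ∂σ.runMeasure, ∃ C : G.MEC, ∀ᶠ t in atTop, (ω t).act ∈ C.1 := by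
  have hnext : ∀ᵐ ω ∂σ.runMeasure, ∀ a s, G.δ a s ≠ 0 → (∃ᶠ t in atTop, (ω t).act = a) →
      ∃ᶠ t in atTop, (ω t).act = a ∧ (ω (t + 1)).state = s := by
    rw [ae_all_iff]; intro a
    rw [ae_all_iff]; intro s
    by_cases hs : G.δ a s = 0
    · simp [hs]
    · have := σ.play.ae_frequently_next {l | l.act = a} {l | l.state = s} (G.prob a s)
        (G.prob_pos_iff.2 hs) (fun l hl => by rw [stepProb_state, (hl : l.act = a)])
      filter_upwards [this] with ω hω _ using hω
  filter_upwards [hnext, σ.ae_src_act, σ.ae_step] with ω h1 h2 h3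
  -- The actions played infinitely often form an end component: `hnext` closes it under successors,
  -- and a tail of the run that uses only `I` connects any two of them.
  set I : Set A := {a | ∃ᶠ t in atTop, (ω t).act = a} with hI
  have hev : ∀ᶠ t in atTop, (ω t).act ∈ I := by
    have : ∀ᶠ t in atTop, ∀ a, a ∉ I → (ω t).act ≠ a := by
      rw [eventually_all]
      intro a
      by_cases ha : a ∈ I
      · simp [ha]
      · simpa [ha] using not_frequently.1 ha
    filter_upwards [this] with t ht
    by_contra hcon
    exact ht _ hcon rfl
  have hEC : G.IsEndComponent I := by
    refine ⟨?_, ?_, ?_⟩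
    · obtain ⟨t, ht⟩ := hev.exists
      exact ⟨_, ht⟩
    · intro a ha s hs
      have hev' : ∀ᶠ t in atTop, (ω (t + 1)).act ∈ I := (tendsto_add_atTop_nat 1).eventually hev
      obtain ⟨t, ⟨-, ht⟩, ht'⟩ := ((h1 a s hs ha).and_eventually hev').exists
      exact ⟨_, ht', (h2 (t + 1)).trans ht⟩
    · intro a ha a' ha'
      obtain ⟨T, hT⟩ := eventually_atTop.1 hev
      obtain ⟨t, htT, rfl⟩ := frequently_atTop.1 ha T
      obtain ⟨t', ht', rfl⟩ := frequently_atTop.1 ha' (t + 1)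
      have hstep : ∀ k ≥ T, G.Step I (ω k).act (ω (k + 1)).act := fun k hk =>
        ⟨hT _ (hk.le.trans k.le_succ), by rw [h2]; exact h3 k⟩
      clear ha'
      induction t', ht' using Nat.le_induction with
      | base => exact Relation.TransGen.single (hstep t htT)
      | succ k hk ih => exact ih.tail (hstep k (htT.trans ((Nat.le_succ t).trans hk)))
  obtain ⟨C, hC⟩ := hEC.exists_mec
  exact ⟨C, hev.mono fun t ht => hC ht⟩

end Strategy

/-! ### Action frequencies -/

section Frequencies

open scoped Classical

set_option linter.unusedSectionVars false

variable {S A : Type*} [Fintype S] [Fintype A] {M : Type*}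

/-- The frequency of an action among the first `T` locations. -/
noncomputable def freq (ω : ℕ → Loc S M A) (T : ℕ) (a : A) : ℝ :=
  (∑ t ∈ Finset.range T, if (ω t).act = a then 1 else 0) / T

theorem freq_nonneg (ω : ℕ → Loc S M A) (T : ℕ) (a : A) : 0 ≤ freq ω T a :=
  div_nonneg (Finset.sum_nonneg fun _ _ => by split_ifs <;> simp) T.cast_nonneg

theorem sum_freq_mul (ω : ℕ → Loc S M A) (T : ℕ) (f : A → ℝ) :
    ∑ a, freq ω T a * f a = (∑ t ∈ Finset.range T, f (ω t).act) / T := by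
  simp only [freq, div_mul_eq_mul_div, ← Finset.sum_div, Finset.sum_mul]
  rw [Finset.sum_comm]
  simp

theorem sum_freq (ω : ℕ → Loc S M A) {T : ℕ} (hT : T ≠ 0) : ∑ a, freq ω T a = 1 := by
  have := sum_freq_mul ω T fun _ => 1
  simp only [mul_one] at this
  rw [this]
  simp [hT]

theorem freq_le_one (ω : ℕ → Loc S M A) (T : ℕ) (a : A) : freq ω T a ≤ 1 := by
  rcases eq_or_ne T 0 with rfl | hT
  · simp [freq]
  · rw [← sum_freq ω hT]
    exact Finset.single_le_sum (fun b _ => freq_nonneg ω T b) (Finset.mem_univ a)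

theorem measurable_freq (T : ℕ) (a : A) : Measurable fun ω : ℕ → Loc S M A => freq ω T a := by
  unfold freq
  refine Measurable.div_const (Finset.measurable_sum _ fun t _ => ?_) _
  exact (Measurable.of_discrete (f := fun l : Loc S M A => if l.act = a then (1 : ℝ) else 0)).comp
    (measurable_pi_apply t)

theorem lrInf_eq_liminf_freq {n : ℕ} (r : A → Fin n → ℚ) (ω : ℕ → Loc S M A) (i : Fin n) :
    lrInf r ω i = liminf (fun T => ∑ a, freq ω T a * (r a i : ℝ)) atTop := by
  simp only [sum_freq_mul, lrInf]

theorem tendsto_freq_of_eventually {ω : ℕ → Loc S M A} {C : Set A} {a : A} (ha : a ∉ C)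
    (h : ∀ᶠ t in atTop, (ω t).act ∈ C) : Tendsto (fun T => freq ω T a) atTop (𝓝 0) := by
  obtain ⟨N, hN⟩ := eventually_atTop.1 h
  have hle : ∀ T, freq ω T a ≤ (N : ℝ) / T := by
    intro T
    refine div_le_div_of_nonneg_right ?_ T.cast_nonneg
    have : ∀ t ∈ Finset.range T, (if (ω t).act = a then (1 : ℝ) else 0) ≤
        if t ∈ Finset.range N then 1 else 0 := by
      intro t _
      by_cases ht : t < N
      · rw [if_pos (Finset.mem_range.2 ht)]
        split_ifs <;> simp
      · rw [if_neg fun e : (ω t).act = a => ha (e ▸ hN t (not_lt.1 ht))]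
        split_ifs <;> simp
    refine (Finset.sum_le_sum this).trans ?_
    rw [Finset.sum_ite_mem, Finset.sum_const, nsmul_eq_mul, mul_one, Nat.cast_le]
    exact (Finset.card_le_card Finset.inter_subset_right).trans (by simp)
  exact tendsto_of_tendsto_of_tendsto_of_le_of_le tendsto_const_nhds
    (tendsto_const_div_atTop_nhds_zero_nat (N : ℝ)) (freq_nonneg ω · a) hle

variable {G : MDP S A} (σ : Strategy G M) [Countable M]

/-- Flow conservation for the frequencies, in the limit. -/
theorem ae_tendsto_inflow_sub_outflow_freq : ∀ᵐ ω ∂σ.runMeasure, ∀ s,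
    Tendsto (fun T => G.inflow (freq ω T) s - G.outflow (freq ω T) s) atTop (𝓝 0) := by
  have h := ae_all_iff.2 fun s => σ.play.ae_tendsto_average {l | l.state = s}
  filter_upwards [h, σ.ae_src_act] with ω h1 h2 s
  set f : ℕ → ℝ := fun t => if (ω t).state = s then 1 else 0 with hf
  have hin : ∀ T, G.inflow (freq ω T) s = (∑ t ∈ Finset.range T, G.prob (ω t).act s) / T :=
    fun T => sum_freq_mul ω T fun a => G.prob a s
  have hout : ∀ T, G.outflow (freq ω T) s = (∑ t ∈ Finset.range T, f t) / T := by
    intro T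
    have := sum_freq_mul ω T fun a => if G.src a = s then 1 else 0
    simp only [mul_ite, mul_one, mul_zero, h2] at this
    exact this
  -- The strong law compares transition probabilities with visits one step later; the shift costs
  -- only a boundary term of order `1 / T`.
  have h3 : Tendsto (fun T : ℕ => (f T - f 0) / (T : ℝ)) atTop (𝓝 0) := by
    refine squeeze_zero_norm (a := fun T : ℕ => (1 : ℝ) / T) (fun T => ?_)
      (tendsto_const_div_atTop_nhds_zero_nat 1)
    rw [norm_div, Real.norm_natCast]
    refine div_le_div_of_nonneg_right ?_ T.cast_nonneg
    simp only [hf]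
    split_ifs <;> simp
  have h4 := h3.sub (h1 s)
  rw [sub_zero] at h4
  refine h4.congr fun T => ?_
  rw [hin, hout, ← sub_div, ← sub_div, Finset.sum_sub_distrib]
  have e1 : ∀ t, ({l : Loc S M A | l.state = s}.indicator (1 : Loc S M A → ℝ) (ω t)) = f t := by
    intro t
    simp [Set.indicator_apply, hf]
  have e2 : ∀ t, σ.play.stepProb {l | l.state = s} (ω t) = G.prob (ω t).act s := fun t =>
    σ.stepProb_state _ _
  simp only [e1, e2]
  have e3 : ∑ t ∈ Finset.range T, f (t + 1) = ∑ t ∈ Finset.range T, f t + (f T - f 0) := by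
    have := Finset.sum_range_sub f T
    rw [Finset.sum_sub_distrib] at this
    linarith
  rw [e3]
  congr 1
  ring

theorem integrable_freq (μ : Measure (ℕ → Loc S M A)) [IsFiniteMeasure μ] (T : ℕ) (a : A) :
    Integrable (fun ω => freq ω T a) μ :=
  Integrable.of_bound (measurable_freq T a).aestronglyMeasurable 1
    (Eventually.of_forall fun ω => by
      rw [Real.norm_eq_abs, abs_of_nonneg (freq_nonneg _ _ _)]; exact freq_le_one _ _ _)

/-- `x` is the limit, along `U`, of the expected frequencies on the event `E`. -/
def IsFreqLimit (U : Filter ℕ) (E : Set (ℕ → Loc S M A)) (x : A → ℝ) : Prop :=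
  ∀ a, Tendsto (fun T => ∫ ω in E, freq ω T a ∂σ.runMeasure) U (𝓝 (x a))

/-- An ultrafilter yields limits for all actions, and later for all pieces of a partition, along the
same filter without extracting subsequences. -/
theorem exists_isFreqLimit (U : Ultrafilter ℕ) (E : Set (ℕ → Loc S M A)) :
    ∃ x, IsFreqLimit σ U E x := by
  have : ∀ a, ∃ x, Tendsto (fun T => ∫ ω in E, freq ω T a ∂σ.runMeasure) U (𝓝 x) := by
    intro a
    have hc : IsCompact (Set.Icc (0 : ℝ) 1) := isCompact_Icc
    obtain ⟨x, -, hx⟩ := hc.ultrafilter_le_nhds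
      (U.map fun T => ∫ ω in E, freq ω T a ∂σ.runMeasure) (by
        rw [le_principal_iff]
        change ∀ᶠ T in (U : Filter ℕ), (∫ ω in E, freq ω T a ∂σ.runMeasure) ∈ Set.Icc (0 : ℝ) 1
        refine Eventually.of_forall fun T => ⟨integral_nonneg fun ω => freq_nonneg _ _ _, ?_⟩
        calc ∫ ω in E, freq ω T a ∂σ.runMeasure ≤ ∫ ω in E, 1 ∂σ.runMeasure :=
              integral_mono (integrable_freq _ T a) (integrable_const _) fun ω =>
                freq_le_one _ _ _
          _ ≤ 1 := by
              rw [setIntegral_const, smul_eq_mul, mul_one]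
              exact measureReal_le_one)
    exact ⟨x, hx⟩
  choose x hx using this
  exact ⟨x, hx⟩

variable {σ} {U : Filter ℕ} [NeBot U] {E : Set (ℕ → Loc S M A)} {x : A → ℝ}

theorem IsFreqLimit.nonneg (h : IsFreqLimit σ U E x) (a : A) : 0 ≤ x a :=
  ge_of_tendsto (h a) (Eventually.of_forall fun _ => integral_nonneg fun _ => freq_nonneg _ _ _)

theorem IsFreqLimit.sum_mul (h : IsFreqLimit σ U E x) (f : A → ℝ) :
    Tendsto (fun T => ∫ ω in E, ∑ a, freq ω T a * f a ∂σ.runMeasure) U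
      (𝓝 (∑ a, x a * f a)) := by
  have h1 := tendsto_finsetSum Finset.univ fun a _ => (h a).mul_const (f a)
  refine h1.congr fun T => ?_
  rw [integral_finsetSum _ fun a _ => (integrable_freq _ T a).mul_const _]
  exact Finset.sum_congr rfl fun a _ => (integral_mul_const _ _).symm

theorem IsFreqLimit.sum_eq (h : IsFreqLimit σ U E x) (hU : U ≤ atTop) :
    ∑ a, x a = σ.runMeasure.real E := by
  have h1 := h.sum_mul fun _ => 1
  simp only [mul_one] at h1
  refine tendsto_nhds_unique h1 (tendsto_const_nhds.congr' ?_)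
  filter_upwards [hU (eventually_ne_atTop 0)] with T hT
  simp [sum_freq _ hT]

/-- Conservation holds almost surely in the limit; dominated convergence carries it over to
expectations on any event. -/
theorem IsFreqLimit.isCirculation (h : IsFreqLimit σ U E x) (hU : U ≤ atTop) :
    G.IsCirculation x := by
  intro s
  have h1 := h.sum_mul fun a => G.prob a s - if G.src a = s then 1 else 0
  have e : ∀ z : A → ℝ, ∑ a, z a * (G.prob a s - if G.src a = s then 1 else 0) =
      G.inflow z s - G.outflow z s := by
    intro z
    simp only [mul_sub, Finset.sum_sub_distrib, mul_ite, mul_one, mul_zero, MDP.inflow,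
      MDP.outflow]
  simp only [e] at h1
  have h2 : Tendsto (fun T => ∫ ω in E, (G.inflow (freq ω T) s - G.outflow (freq ω T) s)
      ∂σ.runMeasure) atTop (𝓝 (∫ ω in E, (0 : ℝ) ∂σ.runMeasure)) := by
    refine tendsto_integral_of_dominated_convergence (fun _ => (1 : ℝ)) ?_
      (integrable_const _) ?_ ?_
    · intro T
      refine Measurable.aestronglyMeasurable ?_
      simp only [← e]
      exact Finset.measurable_sum _ fun a _ => (measurable_freq T a).mul_const _
    · intro T
      refine Eventually.of_forall fun ω => ?_
      have hi0 := G.inflow_nonneg (freq_nonneg ω T) s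
      have ho0 := G.outflow_nonneg (freq_nonneg ω T) s
      have hs : ∑ a, freq ω T a ≤ 1 := by
        rcases eq_or_ne T 0 with rfl | hT
        · simp [freq]
        · exact (sum_freq ω hT).le
      have hi1 : G.inflow (freq ω T) s ≤ 1 := by
        refine le_trans ?_ ((G.sum_inflow _).trans_le hs)
        exact Finset.single_le_sum (fun s _ => G.inflow_nonneg (freq_nonneg ω T) s)
          (Finset.mem_univ s)
      have ho1 : G.outflow (freq ω T) s ≤ 1 := by
        refine le_trans ?_ ((G.sum_outflow _).trans_le hs)
        exact Finset.single_le_sum (fun s _ => G.outflow_nonneg (freq_nonneg ω T) s)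
          (Finset.mem_univ s)
      rw [Real.norm_eq_abs, abs_le]
      constructor <;> linarith
    · filter_upwards [ae_restrict_of_ae (ae_tendsto_inflow_sub_outflow_freq σ)] with ω hω
      exact hω s
  rw [integral_zero] at h2
  exact sub_eq_zero.1 (tendsto_nhds_unique h1 (h2.mono_left hU))

theorem IsFreqLimit.eq_zero (h : IsFreqLimit σ U E x) (hU : U ≤ atTop) {C : Set A}
    (hE : MeasurableSet E) (hEC : ∀ ω ∈ E, ∀ᶠ t in atTop, (ω t).act ∈ C) {a : A} (ha : a ∉ C) :
    x a = 0 := by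
  have h2 : Tendsto (fun T => ∫ ω in E, freq ω T a ∂σ.runMeasure) atTop
      (𝓝 (∫ ω in E, (0 : ℝ) ∂σ.runMeasure)) := by
    refine tendsto_integral_of_dominated_convergence (fun _ => (1 : ℝ))
      (fun T => (measurable_freq T a).aestronglyMeasurable) (integrable_const _) (fun T => ?_) ?_
    · exact Eventually.of_forall fun ω => by
        rw [Real.norm_eq_abs, abs_of_nonneg (freq_nonneg _ _ _)]; exact freq_le_one _ _ _
    · filter_upwards [ae_restrict_mem hE] with ω hω
      exact tendsto_freq_of_eventually ha (hEC ω hω)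
  rw [integral_zero] at h2
  exact tendsto_nhds_unique (h a) (h2.mono_left hU)

theorem exists_abs_reward_le {n : ℕ} (r : A → Fin n → ℚ) :
    ∃ B : ℝ, 0 ≤ B ∧ ∀ a i, |(r a i : ℝ)| ≤ B :=
  ⟨∑ a, ∑ i, |(r a i : ℝ)|, by positivity, fun a i =>
    (Finset.single_le_sum (f := fun i => |(r a i : ℝ)|) (fun _ _ => abs_nonneg _)
      (Finset.mem_univ i)).trans
    (Finset.single_le_sum (f := fun a => ∑ i, |(r a i : ℝ)|)
      (fun _ _ => Finset.sum_nonneg fun _ _ => abs_nonneg _) (Finset.mem_univ a))⟩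

theorem abs_sum_freq_mul_le {n : ℕ} {r : A → Fin n → ℚ} {B : ℝ} (hB0 : 0 ≤ B)
    (hB : ∀ a i, |(r a i : ℝ)| ≤ B)
    (ω : ℕ → Loc S M A) (T : ℕ) (i : Fin n) : |∑ a, freq ω T a * (r a i : ℝ)| ≤ B := by
  rcases eq_or_ne T 0 with rfl | hT
  · simpa [freq] using hB0
  calc |∑ a, freq ω T a * (r a i : ℝ)| ≤ ∑ a, freq ω T a * B := by
        refine (Finset.abs_sum_le_sum_abs _ _).trans (Finset.sum_le_sum fun a _ => ?_)
        rw [abs_mul, abs_of_nonneg (freq_nonneg _ _ _)]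
        exact mul_le_mul_of_nonneg_left (hB a i) (freq_nonneg _ _ _)
    _ = B := by rw [← Finset.sum_mul, sum_freq ω hT, one_mul]

/-- Approximates a bounded liminf by uniformly bounded tail infima, so that Fatou's inequality
follows from dominated convergence even for rewards of either sign. -/
theorem tendsto_iInf_shift_liminf {u : ℕ → ℝ} {B : ℝ} (hu : ∀ n, |u n| ≤ B) :
    Tendsto (fun T => ⨅ j, u (j + T)) atTop (𝓝 (liminf u atTop)) := by
  have hbdd : ∀ T, BddBelow (Set.range fun j => u (j + T)) := fun T =>
    ⟨-B, by rintro _ ⟨j, rfl⟩; exact (abs_le.1 (hu _)).1⟩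
  have hbu : IsBoundedUnder (· ≤ ·) atTop u := isBoundedUnder_of ⟨B, fun T => (abs_le.1 (hu T)).2⟩
  have hbl : IsBoundedUnder (· ≥ ·) atTop u := isBoundedUnder_of ⟨-B, fun T => (abs_le.1 (hu T)).1⟩
  have hmono : Monotone fun T => ⨅ j, u (j + T) := monotone_nat_of_le_succ fun T =>
    le_ciInf fun j => (ciInf_le (hbdd T) (j + 1)).trans_eq (by congr 1; omega)
  have hle : ∀ T, ⨅ j, u (j + T) ≤ liminf u atTop := fun T => by
    refine le_liminf_of_le hbu.isCoboundedUnder_ge ?_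
    filter_upwards [eventually_ge_atTop T] with n hn
    exact (ciInf_le (hbdd T) (n - T)).trans_eq (by congr 1; omega)
  have hbs : BddAbove (Set.range fun T => ⨅ j, u (j + T)) :=
    ⟨liminf u atTop, by rintro _ ⟨T, rfl⟩; exact hle T⟩
  have heq : liminf u atTop = ⨆ T, ⨅ j, u (j + T) := by
    refine le_antisymm (liminf_le_of_le hbl fun b hb => ?_) (ciSup_le hle)
    obtain ⟨N, hN⟩ := eventually_atTop.1 hb
    exact (le_ciInf fun j => hN (j + N) (Nat.le_add_left _ _)).trans (le_ciSup hbs N)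
  rw [heq]
  exact tendsto_atTop_ciSup hmono hbs

/-- Fatou's lemma for the long-run average reward. -/
theorem IsFreqLimit.setIntegral_lrInf_le (h : IsFreqLimit σ U E x) (hU : U ≤ atTop)
    {n : ℕ} (r : A → Fin n → ℚ) (i : Fin n) :
    ∫ ω in E, lrInf r ω i ∂σ.runMeasure ≤ ∑ a, x a * (r a i : ℝ) := by
  obtain ⟨B, hB0, hB⟩ := exists_abs_reward_le r
  set g : ℕ → (ℕ → Loc S M A) → ℝ := fun T ω => ∑ a, freq ω T a * (r a i : ℝ) with hg
  have hgB : ∀ T ω, |g T ω| ≤ B := fun T ω => abs_sum_freq_mul_le hB0 hB ω T i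
  have hgm : ∀ T, Measurable (g T) := fun T =>
    Finset.measurable_sum _ fun a _ => (measurable_freq T a).mul_const _
  have hbdd : ∀ T ω, BddBelow (Set.range fun j => g (j + T) ω) := fun T ω =>
    ⟨-B, by rintro _ ⟨j, rfl⟩; exact (abs_le.1 (hgB _ _)).1⟩
  have hlim : ∀ ω, Tendsto (fun T => ⨅ j, g (j + T) ω) atTop (𝓝 (lrInf r ω i)) := by
    intro ω
    rw [lrInf_eq_liminf_freq]
    exact tendsto_iInf_shift_liminf fun T => hgB T ω
  have hinfB : ∀ T ω, |⨅ j, g (j + T) ω| ≤ B := by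
    intro T ω
    refine abs_le.2 ⟨le_ciInf fun j => (abs_le.1 (hgB _ _)).1, ?_⟩
    exact (ciInf_le (hbdd T ω) 0).trans (abs_le.1 (hgB _ _)).2
  have hinfm : ∀ T, Measurable fun ω => ⨅ j, g (j + T) ω := fun T =>
    Measurable.iInf fun j => hgm (j + T)
  have h1 : Tendsto (fun T => ∫ ω in E, ⨅ j, g (j + T) ω ∂σ.runMeasure) atTop
      (𝓝 (∫ ω in E, lrInf r ω i ∂σ.runMeasure)) :=
    tendsto_integral_of_dominated_convergence (fun _ => B)
      (fun T => (hinfm T).aestronglyMeasurable) (integrable_const _)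
      (fun T => Eventually.of_forall fun ω => hinfB T ω) (Eventually.of_forall hlim)
  refine le_of_tendsto_of_tendsto (h1.mono_left hU) (h.sum_mul fun a => (r a i : ℝ))
    (Eventually.of_forall fun T => ?_)
  refine integral_mono ?_ ?_ fun ω => ?_
  · exact Integrable.of_bound (hinfm T).aestronglyMeasurable B
      (Eventually.of_forall fun ω => hinfB T ω)
  · exact Integrable.of_bound (hgm T).aestronglyMeasurable B
      (Eventually.of_forall fun ω => hgB T ω)
  · have := ciInf_le (hbdd T ω) 0
    rwa [zero_add] at this

/-- The flow that leads from the initial state to the limit frequencies. -/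
theorem IsFreqLimit.exists_flow (h : IsFreqLimit σ U Set.univ x) (hU : U ≤ atTop) :
    ∃ y : A → ℝ, (∀ a, 0 ≤ y a) ∧ ∀ s,
      (if s = G.s₀ then 1 else 0) + G.inflow y s = G.outflow y s + G.outflow x s := by
  set p : ℕ → A → ℝ := fun t a => σ.runMeasure.real {ω | (ω t).act = a} with hp
  have hp0 : ∀ t a, 0 ≤ p t a := fun t a => measureReal_nonneg
  have hind : ∀ t a, ∫ ω, (if (ω t).act = a then (1 : ℝ) else 0) ∂σ.runMeasure = p t a := by
    intro t a
    have : (fun ω : ℕ → Loc S M A => if (ω t).act = a then (1 : ℝ) else 0) =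
        {ω | ω t ∈ {l : Loc S M A | l.act = a}}.indicator 1 := by
      ext ω; simp [Set.indicator_apply]
    rw [this, integral_indicator_one (MarkovChain.measurableSet_mem _ _)]
    rfl
  have hindi : ∀ t a, Integrable (fun ω : ℕ → Loc S M A =>
      if (ω t).act = a then (1 : ℝ) else 0) σ.runMeasure := by
    intro t a
    refine Integrable.of_bound ((Measurable.of_discrete (f := fun l : Loc S M A =>
      if l.act = a then (1 : ℝ) else 0)).comp (measurable_pi_apply t)).aestronglyMeasurable 1
      (Eventually.of_forall fun ω => ?_)
    by_cases h : (ω t).act = a <;> simp [h]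
  have hfun : ∀ (t : ℕ) (f : A → ℝ), ∫ ω, f (ω t).act ∂σ.runMeasure = ∑ a, p t a * f a := by
    intro t f
    have : ∀ ω : ℕ → Loc S M A, f (ω t).act = ∑ a, (if (ω t).act = a then 1 else 0) * f a := by
      intro ω; simp
    simp_rw [this]
    rw [integral_finsetSum _ fun a _ => (hindi t a).mul_const _]
    simp_rw [integral_mul_const, hind]
  have hst : ∀ t s, σ.runMeasure.real {ω | (ω t).state = s} = G.outflow (p t) s := by
    intro t s
    have h1 := hfun t fun a => if G.src a = s then 1 else 0
    simp only [mul_ite, mul_one, mul_zero] at h1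
    rw [MDP.outflow, ← h1]
    have h2 : (fun ω : ℕ → Loc S M A => if G.src (ω t).act = s then (1 : ℝ) else 0) =ᵐ[σ.runMeasure]
        {ω | ω t ∈ {l : Loc S M A | l.state = s}}.indicator 1 := by
      filter_upwards [σ.ae_src_act] with ω hω
      simp [Set.indicator_apply, hω]
    rw [integral_congr_ae h2, integral_indicator_one (MarkovChain.measurableSet_mem _ _)]
    rfl
  have hsucc : ∀ t s, G.outflow (p (t + 1)) s = G.inflow (p t) s := by
    intro t s
    rw [← hst]
    have := σ.play.measureReal_succ_mem t {l | l.state = s}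
    simp only [σ.stepProb_state] at this
    exact this.trans (hfun t fun a => G.prob a s)
  have hzero : ∀ s, G.outflow (p 0) s = if s = G.s₀ then 1 else 0 := by
    intro s
    rw [← hst]
    by_cases hs : s = G.s₀
    · rw [if_pos hs, hs]
      have : σ.runMeasure {ω | (ω 0).state = G.s₀} = 1 := prob_compl_eq_zero_iff₀
        (MarkovChain.measurableSet_mem 0 {l : Loc S M A | l.state = G.s₀}).nullMeasurableSet |>.1
          σ.ae_state_zero
      rw [measureReal_def, this, ENNReal.toReal_one]
    · rw [if_neg hs, measureReal_eq_zero_iff]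
      refine measure_mono_null (fun ω (hω : (ω 0).state = s) => ?_) σ.ae_state_zero
      exact fun h : (ω 0).state = G.s₀ => hs (hω.symm.trans h)
  set v : A → S → ℝ := fun a s => G.prob a s - if G.src a = s then 1 else 0 with hv
  have hyv : ∀ (y : A → ℝ) s, (∑ a, y a • v a) s = G.inflow y s - G.outflow y s := by
    intro y s
    simp only [hv, Finset.sum_apply, Pi.smul_apply, smul_eq_mul, mul_sub, Finset.sum_sub_distrib,
      mul_ite, mul_one, mul_zero, MDP.inflow, MDP.outflow]
  -- Balance up to time `t`: what starts in or enters `s` either leaves before time `t` or is there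
  -- at time `t`.
  have hocc : ∀ t s, (if s = G.s₀ then 1 else 0) + G.inflow (fun a => ∑ j ∈ Finset.range t, p j a) s
      = G.outflow (fun a => ∑ j ∈ Finset.range t, p j a) s + G.outflow (p t) s := by
    intro t s
    rw [MDP.inflow_sum, MDP.outflow_sum, ← Finset.sum_range_succ fun j => G.outflow (p j) s,
      Finset.sum_range_succ']
    simp only [hsucc, hzero]
    ring
  have hfreq : ∀ T a, ∫ ω in Set.univ, freq ω T a ∂σ.runMeasure =
      (T : ℝ)⁻¹ * ∑ t ∈ Finset.range T, p t a := by
    intro T a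
    simp only [Measure.restrict_univ, freq]
    rw [integral_div, integral_finsetSum _ fun t _ => hindi t a]
    simp only [hind]
    rw [div_eq_inv_mul]
  -- Averaging `hocc` over `t < T` puts the horizon-`T` vectors in the cone. The coefficients may
  -- diverge, but the vectors converge, and closedness provides some `y` for the limit.
  have hmem : (fun s => G.outflow x s - if s = G.s₀ then 1 else 0) ∈
      {b | ∃ y : A → ℝ, (∀ a, 0 ≤ y a) ∧ ∑ a, y a • v a = b} := by
    refine (isClosed_nonneg_combinations v).mem_of_tendsto
      (f := fun (T : ℕ) s => G.outflow (fun a => (T : ℝ)⁻¹ * ∑ t ∈ Finset.range T, p t a) s -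
        if s = G.s₀ then 1 else 0) (b := U) ?_ ?_
    · rw [tendsto_pi_nhds]
      intro s
      refine Tendsto.sub_const (tendsto_finsetSum _ fun a _ => ?_) _
      split_ifs
      · exact (h a).congr fun T => hfreq T a
      · exact tendsto_const_nhds
    · filter_upwards [hU (eventually_ne_atTop 0)] with T hT
      refine ⟨fun a => (T : ℝ)⁻¹ * ∑ t ∈ Finset.range T, ∑ j ∈ Finset.range t, p j a,
        fun a => by positivity, ?_⟩
      ext s
      rw [hyv, MDP.inflow_smul, MDP.outflow_smul, MDP.outflow_smul, MDP.inflow_sum,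
        MDP.outflow_sum, MDP.outflow_sum, ← mul_sub, ← Finset.sum_sub_distrib]
      have hT' : (T : ℝ) ≠ 0 := by exact_mod_cast hT
      have h1 : ∀ t ∈ Finset.range T, G.inflow (fun a => ∑ j ∈ Finset.range t, p j a) s -
          G.outflow (fun a => ∑ j ∈ Finset.range t, p j a) s =
          G.outflow (p t) s - if s = G.s₀ then 1 else 0 := fun t _ => by
        linarith [hocc t s]
      rw [Finset.sum_congr rfl h1, Finset.sum_sub_distrib, mul_sub, Finset.sum_const,
        Finset.card_range, nsmul_eq_mul, inv_mul_cancel_left₀ hT']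
  obtain ⟨y, hy0, hy⟩ := hmem
  refine ⟨y, hy0, fun s => ?_⟩
  have := congrFun hy s
  rw [hyv] at this
  linarith

end Frequencies

/-! ### Plans and the strategies they define -/

section Plans

open scoped Classical

variable {S A : Type*} [Fintype S] [Fintype A] {G : MDP S A} {m : ℕ}

/-- The states of a maximal end component. -/
def MDP.MEC.states (C : G.MEC) : Set S := G.src '' C.1

theorem MDP.MEC.eq_of_mem_states {C₁ C₂ : G.MEC} {s : S} (h₁ : s ∈ C₁.states)
    (h₂ : s ∈ C₂.states) : C₁ = C₂ := by
  obtain ⟨a₁, ha₁, rfl⟩ := h₁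
  obtain ⟨a₂, ha₂, h⟩ := h₂
  exact MDP.MEC.eq_of_src ha₁ ha₂ h.symm

theorem MDP.MEC.mem_states_of_step {C : G.MEC} {a : A} {s : S} (ha : a ∈ C.1)
    (hs : G.δ a s ≠ 0) : s ∈ C.states := by
  obtain ⟨a', ha', rfl⟩ := C.isEndComponent.closed a ha s hs
  exact ⟨a', ha', rfl⟩

theorem MDP.MEC.outflow_eq_zero {C : G.MEC} {x : A → ℝ} (hx : ∀ a, a ∉ C.1 → x a = 0) {s : S}
    (hs : s ∉ C.states) : G.outflow x s = 0 :=
  Finset.sum_eq_zero fun a _ => by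
    split_ifs with h
    · exact hx a fun ha => hs ⟨a, ha, h⟩
    · rfl

/-- If frequencies become invariant under a randomized choice, they converge to the invariant
distribution of the end component. -/
theorem tendsto_of_asymptotically_invariant {B : Set A} (hB : G.IsEndComponent B) {u π : A → ℝ}
    (hπ : ∀ a ∈ B, 0 < π a) (hπ0 : ∀ a, a ∉ B → π a = 0)
    (hπu : ∀ a, π a = G.inflow π (G.src a) * u a) (hπ1 : ∑ a, π a = 1) {f : ℕ → A → ℝ}
    (hf0 : ∀ T a, 0 ≤ f T a) (hf1 : ∀ T a, f T a ≤ 1) (hfs : ∀ᶠ T in atTop, ∑ a, f T a = 1)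
    (hfB : ∀ a, a ∉ B → Tendsto (fun T => f T a) atTop (𝓝 0))
    (hfu : ∀ a, Tendsto (fun T => f T a - G.inflow (f T) (G.src a) * u a) atTop (𝓝 0)) :
    Tendsto f atTop (𝓝 π) := by
  rw [tendsto_iff_ultrafilter]
  -- By compactness it suffices to identify limits along ultrafilters; each is an invariant
  -- distribution on `B`, hence equal to `π` by uniqueness.
  intro U hU
  have hc : IsCompact (Set.Icc (0 : A → ℝ) 1) := isCompact_Icc
  obtain ⟨μ, -, hμ⟩ := hc.ultrafilter_le_nhds (U.map f) (by
    rw [le_principal_iff]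
    change ∀ᶠ T in (U : Filter ℕ), f T ∈ Set.Icc (0 : A → ℝ) 1
    exact Eventually.of_forall fun T => ⟨hf0 T, hf1 T⟩)
  have hμ' : Tendsto f U (𝓝 μ) := hμ
  have hμa : ∀ a, Tendsto (fun T => f T a) U (𝓝 (μ a)) := tendsto_pi_nhds.1 hμ'
  have hin : ∀ s, Tendsto (fun T => G.inflow (f T) s) U (𝓝 (G.inflow μ s)) := fun s =>
    tendsto_finsetSum _ fun a _ => (hμa a).mul_const _
  have : μ = π := by
    refine hB.invariant_unique (u := u) hπ hπ0 (fun a ha => ?_) hπu (fun a => ?_) hπ1 ?_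
    · exact tendsto_nhds_unique (hμa a) ((hfB a ha).mono_left hU)
    · exact sub_eq_zero.1 (tendsto_nhds_unique ((hμa a).sub ((hin _).mul_const _))
        ((hfu a).mono_left hU))
    · exact tendsto_nhds_unique (tendsto_finsetSum _ fun a _ => hμa a)
        (tendsto_const_nhds.congr' (Eventually.mono (hU hfs) fun T hT => hT.symm))
  rwa [this] at hμ'

variable (G m) in
/-- A transient flow `y` delivering the flows `x C k` to the maximal end components, together with
the frequencies `π C k` to be played there in the `k`-th mode. -/
structure Plan where
  y : A → ℝ
  x : G.MEC → Fin m → A → ℝ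
  π : G.MEC → Fin m → A → ℝ
  y_nonneg : ∀ a, 0 ≤ y a
  x_nonneg : ∀ C k a, 0 ≤ x C k a
  x_zero : ∀ C k a, a ∉ C.1 → x C k a = 0
  flow : ∀ s, (if s = G.s₀ then 1 else 0) + G.inflow y s =
    G.outflow y s + ∑ k, ∑ C, G.outflow (x C k) s
  π_pos : ∀ C k, ∀ a ∈ C.1, 0 < π C k a
  π_zero : ∀ C k a, a ∉ C.1 → π C k a = 0
  π_sum : ∀ C k, ∑ a, π C k a = 1
  π_circulation : ∀ C k, G.IsCirculation (π C k)

namespace Plan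

variable (p : Plan G m)

/-- The flow entering mode `k` in state `s`. -/
noncomputable def switchFlow (s : S) (k : Fin m) : ℝ := ∑ C, G.outflow (p.x C k) s

/-- The total transient flow arriving in state `s`. -/
noncomputable def arrival (s : S) : ℝ := G.outflow p.y s + ∑ k, p.switchFlow s k

theorem switchFlow_nonneg (s : S) (k : Fin m) : 0 ≤ p.switchFlow s k :=
  Finset.sum_nonneg fun C _ => G.outflow_nonneg (p.x_nonneg C k) s

theorem arrival_nonneg (s : S) : 0 ≤ p.arrival s :=
  add_nonneg (G.outflow_nonneg p.y_nonneg s) (Finset.sum_nonneg fun _ _ => p.switchFlow_nonneg s _)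

theorem arrival_eq (s : S) : p.arrival s = (if s = G.s₀ then 1 else 0) + G.inflow p.y s :=
  (p.flow s).symm

theorem switchFlow_eq {C : G.MEC} {s : S} (hs : s ∈ C.states) (k : Fin m) :
    p.switchFlow s k = G.outflow (p.x C k) s :=
  Finset.sum_eq_single C
    (fun C' _ hC' => C'.outflow_eq_zero (p.x_zero C' k) fun hs' =>
      hC' (MDP.MEC.eq_of_mem_states hs' hs))
    (fun h => absurd (Finset.mem_univ C) h)

theorem exists_mem_states {s : S} {k : Fin m} (h : p.switchFlow s k ≠ 0) :
    ∃ C : G.MEC, s ∈ C.states := by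
  obtain ⟨C, -, hC⟩ := Finset.exists_ne_zero_of_sum_ne_zero h
  refine ⟨C, ?_⟩
  by_contra hs
  exact hC (C.outflow_eq_zero (p.x_zero C k) hs)

/-- The flow arriving in `s` either goes on transiently or enters a mode; normalizing these shares
gives the coin, with index `0` for staying. The support condition ensures that modes are entered
only in states of maximal end components. -/
theorem exists_switch (s : S) : ∃ q : PMF (Fin (m + 1)),
    (∀ k : Fin m, q k.succ ≠ 0 → p.switchFlow s k ≠ 0) ∧
    G.outflow p.y s = p.arrival s * (q 0).toReal ∧
    ∀ k : Fin m, p.switchFlow s k = p.arrival s * (q k.succ).toReal := by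
  obtain ⟨q, h1, h2⟩ := exists_pmf_of_weights
    (Fin.cons (G.outflow p.y s) (p.switchFlow s) : Fin (m + 1) → ℝ)
    (Fin.cases (G.outflow_nonneg p.y_nonneg s) (p.switchFlow_nonneg s))
    {j | ∀ k : Fin m, j = k.succ → p.switchFlow s k ≠ 0}
    -- If nothing arrives in `s`, all switch flows vanish and staying transient is the only
    -- admissible value.
    ⟨0, fun k hk => absurd hk.symm (Fin.succ_ne_zero k)⟩
    (fun j hj k hk => by subst hk; simpa using hj)
  have hsum : ∑ j, (Fin.cons (G.outflow p.y s) (p.switchFlow s) : Fin (m + 1) → ℝ) j =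
      p.arrival s := by
    rw [Fin.sum_univ_succ]
    simp [arrival]
  rw [hsum] at h2
  exact ⟨q, fun k hk => h1 _ hk k rfl, by simpa using h2 0, fun k => by simpa using h2 k.succ⟩

/-- The choice between staying in the transient mode and switching to a mode. -/
noncomputable def switch (s : S) : PMF (Fin (m + 1)) := (p.exists_switch s).choose

theorem exists_transientMove (s : S) : ∃ q : PMF A, (∀ a, q a ≠ 0 → a ∈ G.Act s) ∧
    ∀ a, G.src a = s → p.y a = G.outflow p.y s * (q a).toReal := by
  obtain ⟨q, h1, h2⟩ := exists_pmf_of_weights (fun a => if G.src a = s then p.y a else 0)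
    (fun a => by split_ifs <;> simp [p.y_nonneg]) (G.Act s) (G.act_nonempty s)
    (fun a ha => by
      rw [G.mem_Act_iff]
      by_contra h
      simp [h] at ha)
  refine ⟨q, h1, fun a ha => ?_⟩
  have := h2 a
  rwa [if_pos ha] at this

/-- The move in the transient mode. -/
noncomputable def transientMove (s : S) : PMF A := (p.exists_transientMove s).choose

/-- A state lies in at most one maximal end component, so a single move serves all `C` and a mode
needs no memory of its component. Outside all components any enabled action will do. -/
theorem exists_recurrentMove (k : Fin m) (s : S) : ∃ q : PMF A, (∀ a, q a ≠ 0 → a ∈ G.Act s) ∧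
    ∀ C : G.MEC, s ∈ C.states → (∀ a, q a ≠ 0 → a ∈ C.1) ∧
      ∀ a, G.src a = s → p.π C k a = G.outflow (p.π C k) s * (q a).toReal := by
  by_cases h : ∃ C : G.MEC, s ∈ C.states
  · obtain ⟨C, hC⟩ := h
    obtain ⟨q, h1, h2⟩ := exists_pmf_of_weights (fun a => if G.src a = s then p.π C k a else 0)
      (fun a => by
        split_ifs
        · by_cases ha : a ∈ C.1
          · exact (p.π_pos C k a ha).le
          · exact (p.π_zero C k a ha).ge
        · exact le_rfl) {a | a ∈ C.1 ∧ G.src a = s} hC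
      (fun a ha => by
        by_contra hcon
        by_cases hs : G.src a = s
        · rw [if_pos hs] at ha
          exact hcon ⟨by_contra fun hn => ha (p.π_zero C k a hn), hs⟩
        · simp [hs] at ha)
    refine ⟨q, fun a ha => G.mem_Act_iff.2 (h1 a ha).2, fun C' hC' => ?_⟩
    obtain rfl := MDP.MEC.eq_of_mem_states hC hC'
    refine ⟨fun a ha => (h1 a ha).1, fun a ha => ?_⟩
    have := h2 a
    rwa [if_pos ha] at this
  · obtain ⟨a, ha⟩ := G.act_nonempty s
    refine ⟨PMF.pure a, fun b hb => ?_, fun C hC => absurd ⟨C, hC⟩ h⟩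
    have : b = a := by simpa using hb
    rwa [this]

/-- The move in the mode `k`. -/
noncomputable def recurrentMove (k : Fin m) (s : S) : PMF A := (p.exists_recurrentMove k s).choose

/-- The strategy realizing a plan; memory `0` is the transient mode. -/
noncomputable def strategy : Strategy G (Fin (m + 1)) where
  upd := fun _ s => Fin.cases (p.switch s) fun k => PMF.pure k.succ
  next := fun s => Fin.cases (p.transientMove s) fun k => p.recurrentMove k s
  init := p.switch G.s₀
  next_enabled := fun s j => by
    refine Fin.cases ?_ (fun k => ?_) j
    · exact (p.exists_transientMove s).choose_spec.1
    · exact (p.exists_recurrentMove k s).choose_spec.1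

theorem upd_zero (a : A) (s : S) : p.strategy.upd a s 0 = p.switch s := rfl

theorem upd_succ (a : A) (s : S) (k : Fin m) :
    p.strategy.upd a s k.succ = PMF.pure k.succ := rfl

theorem switch_succ_ne_zero {s : S} {k : Fin m} (h : p.switch s k.succ ≠ 0) :
    ∃ C : G.MEC, s ∈ C.states :=
  p.exists_mem_states ((p.exists_switch s).choose_spec.1 k h)

theorem next_succ_mem {C : G.MEC} {s : S} (hs : s ∈ C.states) {k : Fin m} {a : A}
    (h : p.strategy.next s k.succ a ≠ 0) : a ∈ C.1 :=
  ((p.exists_recurrentMove k s).choose_spec.2 C hs).1 a h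

/-- Conservation replaces the outflow by the inflow in the defining ratio of the move, so `π` is
invariant under mode `k`. -/
theorem π_eq {C : G.MEC} (k : Fin m) (a : A) :
    p.π C k a = G.inflow (p.π C k) (G.src a) * (p.strategy.next (G.src a) k.succ a).toReal := by
  rw [p.π_circulation C k]
  by_cases hs : G.src a ∈ C.states
  · exact ((p.exists_recurrentMove k (G.src a)).choose_spec.2 C hs).2 a rfl
  · rw [C.outflow_eq_zero (p.π_zero C k) hs, zero_mul]
    exact p.π_zero C k a fun ha => hs ⟨a, ha, rfl⟩

/-- In a mode `k`, only actions of maximal end components are played. -/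
theorem ae_exists_mec_of_mem : ∀ᵐ ω ∂p.strategy.runMeasure, ∀ t, (ω t).mem ≠ 0 →
    ∃ C : G.MEC, (ω t).act ∈ C.1 := by
  have h1 := p.strategy.play.ae_zero (Q := fun l => l.mem ≠ 0 → ∃ C : G.MEC, l.act ∈ C.1)
    fun ⟨s, j, a⟩ hl hj => by
      rw [Strategy.play_μ_apply] at hl
      obtain ⟨k, rfl⟩ := Fin.exists_succ_eq.2 hj
      have h2 : s = G.s₀ := by
        by_contra h
        simp [h] at hl
      subst h2
      obtain ⟨C, hC⟩ := p.switch_succ_ne_zero (right_ne_zero_of_mul (left_ne_zero_of_mul hl))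
      exact ⟨C, p.next_succ_mem hC (right_ne_zero_of_mul hl)⟩
  have h2 := p.strategy.play.ae_succ
    (R := fun l l' => (l.mem ≠ 0 → ∃ C : G.MEC, l.act ∈ C.1) → l'.mem ≠ 0 →
      ∃ C : G.MEC, l'.act ∈ C.1)
    fun ⟨s, j, a⟩ ⟨s', j', a'⟩ hl hj hj' => by
      rw [Strategy.play_P_apply] at hl
      obtain ⟨k', rfl⟩ := Fin.exists_succ_eq.2 hj'
      have hs' := left_ne_zero_of_mul (left_ne_zero_of_mul hl)
      have hu := right_ne_zero_of_mul (left_ne_zero_of_mul hl)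
      have hn := right_ne_zero_of_mul hl
      rcases Fin.eq_zero_or_eq_succ j with rfl | ⟨k, rfl⟩
      · obtain ⟨C, hC⟩ := p.switch_succ_ne_zero hu
        exact ⟨C, p.next_succ_mem hC hn⟩
      · obtain ⟨C, hC⟩ := hj (Fin.succ_ne_zero k)
        exact ⟨C, p.next_succ_mem (C.mem_states_of_step hC hs') hn⟩
  filter_upwards [h1, h2] with ω h1 h2 t
  induction t with
  | zero => exact h1
  | succ t ih => exact h2 t ih

/-- Modes and maximal end components are never left. -/
theorem ae_mem_succ : ∀ᵐ ω ∂p.strategy.runMeasure, ∀ t (k : Fin m), (ω t).mem = k.succ →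
    (ω (t + 1)).mem = k.succ ∧
      ∀ C : G.MEC, (ω t).act ∈ C.1 → (ω (t + 1)).act ∈ C.1 :=
  p.strategy.play.ae_succ
    (R := fun l l' => ∀ k : Fin m, l.mem = k.succ →
      l'.mem = k.succ ∧ ∀ C : G.MEC, l.act ∈ C.1 → l'.act ∈ C.1)
    fun ⟨s, j, a⟩ ⟨s', j', a'⟩ hl k hk => by
      dsimp only at hk
      subst hk
      rw [Strategy.play_P_apply, upd_succ] at hl
      have hs' := left_ne_zero_of_mul (left_ne_zero_of_mul hl)
      have hu := right_ne_zero_of_mul (left_ne_zero_of_mul hl)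
      have hn := right_ne_zero_of_mul hl
      have hj' : j' = k.succ := by simpa using hu
      subst hj'
      exact ⟨rfl, fun C hC => p.next_succ_mem (C.mem_states_of_step hC hs') hn⟩

/-- The runs that end up in mode `k` and in the maximal end component `C`. -/
def absorbed (C : G.MEC) (k : Fin m) : Set (ℕ → Loc S (Fin (m + 1)) A) :=
  {ω | ∀ᶠ t in atTop, (ω t).mem = k.succ ∧ (ω t).act ∈ C.1}

theorem measurableSet_absorbed (C : G.MEC) (k : Fin m) : MeasurableSet (absorbed C k) := by
  have : absorbed C k = ⋃ N, ⋂ t ≥ N, {ω : ℕ → Loc S (Fin (m + 1)) A |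
      ω t ∈ {l : Loc S (Fin (m + 1)) A | l.mem = k.succ ∧ l.act ∈ C.1}} := by
    ext ω
    simp [absorbed, eventually_atTop]
  rw [this]
  exact MeasurableSet.iUnion fun N => MeasurableSet.iInter fun t =>
    MeasurableSet.iInter fun _ => MarkovChain.measurableSet_mem _ _

theorem disjoint_absorbed {i j : G.MEC × Fin m} (h : i ≠ j) :
    Disjoint (absorbed i.1 i.2) (absorbed j.1 j.2) := by
  rw [Set.disjoint_left]
  intro ω h1 h2
  obtain ⟨t, ⟨h3, h4⟩, h5, h6⟩ := (Eventually.and h1 h2).exists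
  refine h (Prod.ext (MDP.MEC.eq_of_src h4 h6 rfl) (Fin.succ_injective _ (h3.symm.trans h5)))

/-- Frequencies on absorbed runs. -/
theorem ae_tendsto_freq : ∀ᵐ ω ∂p.strategy.runMeasure, ∀ (C : G.MEC) (k : Fin m),
    ω ∈ absorbed C k → ∀ a, Tendsto (fun T => freq ω T a) atTop (𝓝 (p.π C k a)) := by
  -- One strong law for each location consisting of a mode, an action and the source of that action.
  have h0 (i : Fin m × A) := p.strategy.play.ae_tendsto_average
    ({⟨G.src i.2, i.1.succ, i.2⟩} : Set (Loc S (Fin (m + 1)) A))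
  have h := ae_all_iff.2 h0
  filter_upwards [h, p.strategy.ae_src_act] with ω h1 h2 C k hω
  suffices hlim : Tendsto (freq ω) atTop (𝓝 (p.π C k)) from tendsto_pi_nhds.1 hlim
  refine tendsto_of_asymptotically_invariant C.isEndComponent (p.π_pos C k) (p.π_zero C k)
    (p.π_eq k) (p.π_sum C k) (f := freq ω)
    (freq_nonneg ω) (freq_le_one ω) ?_ ?_ ?_
  · filter_upwards [eventually_ne_atTop 0] with T hT using sum_freq ω hT
  · exact fun a ha => tendsto_freq_of_eventually ha (hω.mono fun t ht => ht.2)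
  · intro a
    set c : ℝ := (p.strategy.next (G.src a) k.succ a).toReal with hc
    set f : ℕ → ℝ := fun t => ({⟨G.src a, k.succ, a⟩} : Set (Loc S (Fin (m + 1)) A)).indicator
      (1 : Loc S (Fin (m + 1)) A → ℝ) (ω (t + 1)) -
        p.strategy.play.stepProb {⟨G.src a, k.succ, a⟩} (ω t) with hf
    set e : ℕ → ℝ := fun t => if (ω t).act = a then 1 else 0 with he
    set g : ℕ → ℝ := fun t => e (t + 1) - G.prob (ω t).act (G.src a) * c with hg
    -- Once a run is absorbed its memory is constant and updated deterministically, so the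
    -- martingale difference for this location reduces to one about actions alone. Finitely many
    -- exceptional times vanish in the average.
    have hfg : ∀ᶠ t in atTop, g t - f t = 0 := by
      filter_upwards [hω, (tendsto_add_atTop_nat 1).eventually hω] with t ht ht'
      have e1 : ({⟨G.src a, k.succ, a⟩} : Set (Loc S (Fin (m + 1)) A)).indicator
          (1 : Loc S (Fin (m + 1)) A → ℝ) (ω (t + 1)) = e (t + 1) := by
        by_cases ha : (ω (t + 1)).act = a
        · rw [Set.indicator_of_mem]
          · simp [he, ha]
          · exact Loc.ext ((h2 (t + 1)).symm.trans (congrArg G.src ha)) ht'.1 ha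
        · rw [Set.indicator_of_notMem]
          · simp [he, ha]
          · exact fun h => ha (congrArg Loc.act h)
      have e2 : p.strategy.play.stepProb {⟨G.src a, k.succ, a⟩} (ω t) =
          G.prob (ω t).act (G.src a) * c := by
        rw [Strategy.stepProb_loc, ht.1, upd_succ]
        simp [hc]
      simp only [hg, hf]
      rw [e1, e2, sub_self]
    have h3 : Tendsto (fun T : ℕ => (T : ℝ)⁻¹ * ∑ t ∈ Finset.range T, (g t - f t)) atTop (𝓝 0) :=
      (tendsto_const_nhds.congr' (hfg.mono fun t ht => ht.symm)).cesaro
    have h4 : Tendsto (fun T : ℕ => (e T - e 0) / (T : ℝ)) atTop (𝓝 0) := by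
      refine squeeze_zero_norm (a := fun T : ℕ => (1 : ℝ) / T) (fun T => ?_)
        (tendsto_const_div_atTop_nhds_zero_nat 1)
      rw [norm_div, Real.norm_natCast]
      refine div_le_div_of_nonneg_right ?_ T.cast_nonneg
      simp only [he]
      split_ifs <;> simp
    have h5 := (h3.add (h1 (k, a))).sub h4
    rw [add_zero, sub_zero] at h5
    refine h5.congr fun T => ?_
    have e3 : ∑ t ∈ Finset.range T, e (t + 1) = ∑ t ∈ Finset.range T, e t + (e T - e 0) := by
      have := Finset.sum_range_sub e T
      rw [Finset.sum_sub_distrib] at this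
      linarith
    have e4 : freq ω T a = (∑ t ∈ Finset.range T, e t) / T := rfl
    have e5 : G.inflow (freq ω T) (G.src a) =
        (∑ t ∈ Finset.range T, G.prob (ω t).act (G.src a)) / T :=
      sum_freq_mul ω T fun b => G.prob b (G.src a)
    rw [e4, e5, Finset.sum_sub_distrib]
    change (T : ℝ)⁻¹ * (∑ t ∈ Finset.range T, g t - ∑ t ∈ Finset.range T, f t) +
      (∑ t ∈ Finset.range T, f t) / T - (e T - e 0) / T = _
    simp only [hg]
    rw [Finset.sum_sub_distrib, e3, ← Finset.sum_mul]
    ring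

end Plan

end Plans

/-! ### Absorption probabilities and rewards of a plan -/

namespace Plan

open scoped Classical

variable {S A : Type*} [Fintype S] [Fintype A] {G : MDP S A} {m : ℕ} (p : Plan G m)

/-- Total mass sent to a maximal end component in a mode. -/
noncomputable def mass (i : G.MEC × Fin m) : ℝ := ∑ a, p.x i.1 i.2 a

/-- Summing the flow equation over all states cancels the transient flow and leaves the unit
injected at the initial state. -/
theorem sum_mass : ∑ i, p.mass i = 1 := by
  have h : ∑ s, ((if s = G.s₀ then (1 : ℝ) else 0) + G.inflow p.y s) =
      ∑ s, (G.outflow p.y s + ∑ k, ∑ C, G.outflow (p.x C k) s) :=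
    Finset.sum_congr rfl fun s _ => p.flow s
  rw [Finset.sum_add_distrib, Finset.sum_add_distrib, MDP.sum_inflow, MDP.sum_outflow,
    Finset.sum_comm] at h
  simp only [Finset.sum_ite_eq', Finset.mem_univ, if_true] at h
  have h2 : ∑ k, ∑ s, ∑ C, G.outflow (p.x C k) s = ∑ i, p.mass i := by
    rw [Fintype.sum_prod_type_right]
    refine Finset.sum_congr rfl fun k _ => ?_
    rw [Finset.sum_comm]
    exact Finset.sum_congr rfl fun C _ => G.sum_outflow _
  linarith

/-- The runs that at time `t` have just arrived, from the transient mode, in the location with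
memory `j` and action `a`. -/
def fresh (j : Fin (m + 1)) (a : A) : ℕ → Set (ℕ → Loc S (Fin (m + 1)) A)
  | 0 => {ω | ω 0 = ⟨G.src a, j, a⟩}
  | t + 1 => {ω | (ω t).mem = 0 ∧ ω (t + 1) = ⟨G.src a, j, a⟩}

/-- The probability of playing `a` in the transient mode at time `t`. -/
noncomputable def transientProb (t : ℕ) (a : A) : ℝ :=
  p.strategy.runMeasure.real {ω | (ω t).mem = 0 ∧ (ω t).act = a}

/-- The probability of arriving from the transient mode in `s` at time `t`. -/
noncomputable def arrivalProb : ℕ → S → ℝ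
  | 0, s => if s = G.s₀ then 1 else 0
  | t + 1, s => G.inflow (p.transientProb t) s

theorem transientProb_nonneg (t : ℕ) (a : A) : 0 ≤ p.transientProb t a := measureReal_nonneg

theorem setIntegral_prob (t : ℕ) (s : S) :
    ∫ ω in {ω | ω t ∈ {l : Loc S (Fin (m + 1)) A | l.mem = 0}}, G.prob (ω t).act s
      ∂p.strategy.runMeasure = G.inflow (p.transientProb t) s := by
  have h : ∀ ω : ℕ → Loc S (Fin (m + 1)) A, G.prob (ω t).act s =
      ∑ a, {ω : ℕ → Loc S (Fin (m + 1)) A |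
        ω t ∈ {l : Loc S (Fin (m + 1)) A | l.act = a}}.indicator (fun _ => (1 : ℝ)) ω * G.prob a s := by
    intro ω
    simp [Set.indicator_apply]
  simp_rw [h]
  rw [integral_finsetSum _ fun a _ => (((integrable_const (1 : ℝ)).indicator
    (MarkovChain.measurableSet_mem _ _)).mul_const _)]
  refine Finset.sum_congr rfl fun a _ => ?_
  rw [integral_mul_const, setIntegral_indicator (MarkovChain.measurableSet_mem _ _)]
  congr 1
  simp only [setIntegral_const, smul_eq_mul, mul_one]
  rfl

/-- A location reached from the transient mode is drawn by arriving, tossing the coin and moving.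
The initial memory is drawn from the same coin, so the formula also covers time `0`. -/
theorem measureReal_fresh (j : Fin (m + 1)) (a : A) (t : ℕ) :
    p.strategy.runMeasure.real (fresh (G := G) j a t) = p.arrivalProb t (G.src a) *
      (p.switch (G.src a) j).toReal * (p.strategy.next (G.src a) j a).toReal := by
  cases t with
  | zero =>
    rw [fresh, measureReal_def, Strategy.runMeasure, MarkovChain.measure_zero_eq,
      Strategy.play_μ_apply, ENNReal.toReal_mul, ENNReal.toReal_mul]
    by_cases h : G.src a = G.s₀
    · rw [arrivalProb, if_pos h, if_pos h, h, ENNReal.toReal_one]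
      rfl
    · simp only [if_neg h, arrivalProb, ENNReal.toReal_zero, zero_mul]
  | succ t =>
    have h := p.strategy.play.integral_next_indicator t {⟨G.src a, j, a⟩}
      (H := {ω | ω t ∈ {l : Loc S (Fin (m + 1)) A | l.mem = 0}})
      (MarkovChain.measurable_filtration le_rfl MeasurableSet.of_discrete)
    refine Eq.trans ?_ (h.trans ?_)
    · rfl
    · rw [setIntegral_congr_fun (g := fun ω => G.prob (ω t).act (G.src a) *
        ((p.switch (G.src a) j).toReal * (p.strategy.next (G.src a) j a).toReal))
        (MarkovChain.measurableSet_mem _ _), integral_mul_const]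
      · refine (congrArg (· * _) (p.setIntegral_prob t (G.src a))).trans ?_
        rw [arrivalProb, mul_assoc]
      · intro ω hω
        have : (ω t).mem = 0 := hω
        dsimp only
        rw [Strategy.stepProb_loc, this, upd_zero, mul_assoc]

theorem sum_arrivalProb (T : ℕ) (s : S) : ∑ t ∈ Finset.range (T + 1), p.arrivalProb t s =
    (if s = G.s₀ then 1 else 0) + G.inflow (fun a => ∑ t ∈ Finset.range T, p.transientProb t a) s := by
  rw [Finset.sum_range_succ', MDP.inflow_sum, add_comm]
  rfl

/-- Modes are never left, so a transient location can only come from a transient one. -/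
theorem transientProb_le (t : ℕ) (a : A) :
    p.transientProb t a ≤ p.strategy.runMeasure.real (fresh (G := G) 0 a t) := by
  refine ENNReal.toReal_mono (measure_ne_top _ _) (measure_mono_ae ?_)
  filter_upwards [p.strategy.ae_src_act, p.ae_mem_succ] with ω h1 h2 h3
  obtain ⟨h3, h4⟩ := h3
  have h5 : ω t = ⟨G.src a, 0, a⟩ := Loc.ext ((h1 t).symm.trans (congrArg G.src h4)) h3 h4
  cases t with
  | zero => exact h5
  | succ t =>
    refine ⟨?_, h5⟩
    by_contra hne
    obtain ⟨k, hk⟩ := Fin.exists_succ_eq.2 hne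
    exact Fin.succ_ne_zero k ((h2 t k hk.symm).1.symm.trans h3)

/-- Expected occupation obeys a monotone recursion that starts at zero and has `y` as a fixed point,
so it stays below `y`. Equality may fail, since `y` may contain circulations that the strategy never
reaches. -/
theorem sum_transientProb_le (T : ℕ) (a : A) :
    ∑ t ∈ Finset.range T, p.transientProb t a ≤ p.y a := by
  induction T generalizing a with
  | zero => simpa using p.y_nonneg a
  | succ T ih =>
    set c : ℝ := (p.switch (G.src a) 0).toReal * (p.strategy.next (G.src a) 0 a).toReal with hc
    have hc0 : 0 ≤ c := mul_nonneg ENNReal.toReal_nonneg ENNReal.toReal_nonneg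
    calc ∑ t ∈ Finset.range (T + 1), p.transientProb t a
        ≤ ∑ t ∈ Finset.range (T + 1), p.arrivalProb t (G.src a) * c :=
          Finset.sum_le_sum fun t _ => (p.transientProb_le t a).trans_eq (by
            rw [measureReal_fresh, mul_assoc])
      _ ≤ p.arrival (G.src a) * c := by
          rw [← Finset.sum_mul, sum_arrivalProb, arrival_eq]
          refine mul_le_mul_of_nonneg_right (add_le_add_right ?_ _) hc0
          exact Finset.sum_le_sum fun b _ =>
            mul_le_mul_of_nonneg_right (ih b) (G.prob_nonneg _ _)
      _ = p.y a := by
          rw [hc, ← mul_assoc]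
          refine Eq.trans ?_ ((p.exists_transientMove (G.src a)).choose_spec.2 a rfl).symm
          exact congrArg (· * _) (p.exists_switch (G.src a)).choose_spec.2.1.symm

theorem sum_arrivalProb_le (T : ℕ) (s : S) :
    ∑ t ∈ Finset.range T, p.arrivalProb t s ≤ p.arrival s := by
  cases T with
  | zero => simpa using p.arrival_nonneg s
  | succ T =>
    rw [sum_arrivalProb, arrival_eq]
    refine add_le_add_right ?_ _
    exact Finset.sum_le_sum fun b _ =>
      mul_le_mul_of_nonneg_right (p.sum_transientProb_le T b) (G.prob_nonneg _ _)

/-- The probability of being in mode `k` and the maximal end component `C` at time `t`. -/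
noncomputable def modeProb (i : G.MEC × Fin m) (t : ℕ) : ℝ :=
  p.strategy.runMeasure.real {ω | (ω t).mem = i.2.succ ∧ (ω t).act ∈ i.1.1}

/-- Modes and components are never left, so whoever is in `(C, k)` at time `T` entered it freshly at
some time up to `T`. -/
theorem modeProb_le_sum (i : G.MEC × Fin m) (T : ℕ) :
    p.modeProb i T ≤ ∑ t ∈ Finset.range (T + 1), ∑ a with a ∈ i.1.1,
      p.strategy.runMeasure.real (fresh (G := G) i.2.succ a t) := by
  induction T with
  | zero =>
    rw [Finset.sum_range_one]
    refine le_trans ?_ (measureReal_biUnion_finset_le _ _)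
    refine ENNReal.toReal_mono (measure_ne_top _ _) (measure_mono_ae ?_)
    filter_upwards [p.strategy.ae_src_act] with ω h1 h2
    exact Set.mem_biUnion (x := (ω 0).act)
      (by simpa using h2.2) (Loc.ext (h1 0).symm h2.1 rfl)
  | succ T ih =>
    rw [Finset.sum_range_succ]
    refine le_trans ?_ (add_le_add ih (measureReal_biUnion_finset_le _ _))
    refine le_trans ?_ (measureReal_union_le _ _)
    refine ENNReal.toReal_mono (measure_ne_top _ _) (measure_mono_ae ?_)
    filter_upwards [p.strategy.ae_src_act, p.ae_mem_succ, p.ae_exists_mec_of_mem]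
      with ω h1 h2 h3 h4
    by_cases h0 : (ω T).mem = 0
    · right
      exact Set.mem_biUnion (x := (ω (T + 1)).act)
        (by simpa using h4.2) ⟨h0, Loc.ext (h1 (T + 1)).symm h4.1 rfl⟩
    · left
      obtain ⟨C, hC⟩ := h3 T h0
      obtain ⟨k, hk⟩ := Fin.exists_succ_eq.2 h0
      obtain ⟨h5, h6⟩ := h2 T k hk.symm
      have hCi := MDP.MEC.eq_of_src (h6 C hC) h4.2 rfl
      have hki : k.succ = i.2.succ := h5.symm.trans h4.1
      exact ⟨hk.symm.trans hki, hCi ▸ hC⟩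

/-- Expected arrivals are at most `arrival`, so the entries into mode `k` at each state of `C` are
at most the flow of `x C k` there; these flows sum to the mass. -/
theorem modeProb_le (i : G.MEC × Fin m) (T : ℕ) : p.modeProb i T ≤ p.mass i := by
  obtain ⟨C, k⟩ := i
  refine (p.modeProb_le_sum _ T).trans ?_
  rw [Finset.sum_comm]
  set n : A → ℝ := fun a => (p.strategy.next (G.src a) k.succ a).toReal with hn
  have h1 : ∀ a ∈ Finset.univ.filter (· ∈ C.1),
      ∑ t ∈ Finset.range (T + 1), p.strategy.runMeasure.real (fresh (G := G) k.succ a t) ≤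
        G.outflow (p.x C k) (G.src a) * n a := by
    intro a ha
    rw [Finset.mem_filter] at ha
    have hs : G.src a ∈ C.states := ⟨a, ha.2, rfl⟩
    simp only [measureReal_fresh, mul_assoc]
    rw [← Finset.sum_mul, ← p.switchFlow_eq hs, (p.exists_switch (G.src a)).choose_spec.2.2 k,
      mul_assoc]
    exact mul_le_mul_of_nonneg_right (p.sum_arrivalProb_le _ _)
      (mul_nonneg ENNReal.toReal_nonneg ENNReal.toReal_nonneg)
  calc ∑ a with a ∈ C.1, ∑ t ∈ Finset.range (T + 1),
        p.strategy.runMeasure.real (fresh (G := G) k.succ a t)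
      ≤ ∑ a with a ∈ C.1, G.outflow (p.x C k) (G.src a) * n a := Finset.sum_le_sum h1
    _ ≤ ∑ a, G.outflow (p.x C k) (G.src a) * n a :=
        Finset.sum_le_sum_of_subset_of_nonneg (Finset.filter_subset _ _) fun a _ _ =>
          mul_nonneg (G.outflow_nonneg (p.x_nonneg C k) _) ENNReal.toReal_nonneg
    _ = ∑ a, ∑ s, if G.src a = s then
          G.outflow (p.x C k) s * (p.strategy.next s k.succ a).toReal else 0 := by
        simp [hn]
    _ ≤ ∑ a, ∑ s, G.outflow (p.x C k) s * (p.strategy.next s k.succ a).toReal := by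
        refine Finset.sum_le_sum fun a _ => Finset.sum_le_sum fun s _ => ?_
        split_ifs
        · exact le_rfl
        · exact mul_nonneg (G.outflow_nonneg (p.x_nonneg C k) _) ENNReal.toReal_nonneg
    _ = p.mass (C, k) := by
        rw [Finset.sum_comm]
        simp_rw [← Finset.mul_sum, MDP.sum_toReal_pmf, mul_one]
        exact G.sum_outflow _

theorem modeProb_le_absorbed (i : G.MEC × Fin m) (T : ℕ) :
    p.modeProb i T ≤ p.strategy.runMeasure.real (absorbed i.1 i.2) := by
  refine ENNReal.toReal_mono (measure_ne_top _ _) (measure_mono_ae ?_)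
  filter_upwards [p.ae_mem_succ] with ω h1 h2
  refine eventually_atTop.2 ⟨T, fun t ht => ?_⟩
  induction t, ht using Nat.le_induction with
  | base => exact h2
  | succ t _ ih => exact ⟨(h1 t _ ih.1).1, (h1 t _ ih.1).2 _ ih.2⟩

theorem one_le_transient_add_modeProb (T : ℕ) :
    1 ≤ ∑ a, p.transientProb T a + ∑ i, p.modeProb i T := by
  have h1 : (1 : ℝ) = p.strategy.runMeasure.real Set.univ := by simp
  rw [h1]
  refine le_trans ?_ (add_le_add (measureReal_biUnion_finset_le _ _)
    (measureReal_biUnion_finset_le _ _))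
  refine le_trans ?_ (measureReal_union_le _ _)
  refine ENNReal.toReal_mono (measure_ne_top _ _) (measure_mono_ae ?_)
  filter_upwards [p.ae_exists_mec_of_mem] with ω h2 _
  by_cases h0 : (ω T).mem = 0
  · left
    exact Set.mem_biUnion (x := (ω T).act) (by simp) ⟨h0, rfl⟩
  · right
    obtain ⟨C, hC⟩ := h2 T h0
    obtain ⟨k, hk⟩ := Fin.exists_succ_eq.2 h0
    exact Set.mem_biUnion (x := (C, k)) (by simp) ⟨hk.symm, hC⟩

/-- The expected total time in the transient mode is finite, being bounded by the total of `y`. -/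
theorem tendsto_sum_transientProb :
    Tendsto (fun T => ∑ a, p.transientProb T a) atTop (𝓝 0) := by
  refine (summable_of_sum_range_le (c := ∑ a, p.y a)
    (fun T => Finset.sum_nonneg fun a _ => p.transientProb_nonneg T a)
    fun T => ?_).tendsto_atTop_zero
  rw [Finset.sum_comm]
  exact Finset.sum_le_sum fun a _ => p.sum_transientProb_le T a

theorem sum_measureReal_absorbed_le :
    ∑ i : G.MEC × Fin m, p.strategy.runMeasure.real (absorbed i.1 i.2) ≤ 1 := by
  rw [← measureReal_biUnion_finset (fun i _ j _ hij => disjoint_absorbed hij)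
    fun i _ => measurableSet_absorbed i.1 i.2]
  exact measureReal_le_one

/-- The masses of a plan are the absorption probabilities of its strategy. -/
theorem measureReal_absorbed (i : G.MEC × Fin m) :
    p.strategy.runMeasure.real (absorbed i.1 i.2) = p.mass i := by
  -- The upper bounds on mode probabilities add up to `1`, and the transient part vanishes in the
  -- limit, so no mode can fall short of its mass. As disjoint events have total at most `1`,
  -- equality follows.
  have hle : ∀ i : G.MEC × Fin m,
      p.mass i ≤ p.strategy.runMeasure.real (absorbed i.1 i.2) := by
    intro i
    have h1 : ∀ T, p.mass i - ∑ a, p.transientProb T a ≤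
        p.strategy.runMeasure.real (absorbed i.1 i.2) := by
      intro T
      have h2 := p.one_le_transient_add_modeProb T
      rw [← p.sum_mass, ← Finset.add_sum_erase _ _ (Finset.mem_univ i),
        ← Finset.add_sum_erase _ (fun i => p.modeProb i T) (Finset.mem_univ i)] at h2
      have h3 : ∑ j ∈ Finset.univ.erase i, p.modeProb j T ≤
          ∑ j ∈ Finset.univ.erase i, p.mass j :=
        Finset.sum_le_sum fun j _ => p.modeProb_le j T
      have h4 := p.modeProb_le_absorbed i T
      linarith
    have h5 := p.tendsto_sum_transientProb.const_sub (p.mass i)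
    rw [sub_zero] at h5
    exact le_of_tendsto h5 (Eventually.of_forall h1)
  have hsum : ∑ i, p.mass i =
      ∑ i : G.MEC × Fin m, p.strategy.runMeasure.real (absorbed i.1 i.2) :=
    le_antisymm (Finset.sum_le_sum fun i _ => hle i)
      (p.sum_measureReal_absorbed_le.trans_eq p.sum_mass.symm)
  exact ((Finset.sum_eq_sum_iff_of_le fun i _ => hle i).1 hsum i (Finset.mem_univ i)).symm

theorem ae_exists_absorbed : ∀ᵐ ω ∂p.strategy.runMeasure, ∃ i : G.MEC × Fin m,
    ω ∈ absorbed i.1 i.2 := by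
  have hm : MeasurableSet (⋃ i ∈ (Finset.univ : Finset (G.MEC × Fin m)), absorbed i.1 i.2) :=
    Finset.measurableSet_biUnion _ fun i _ => measurableSet_absorbed i.1 i.2
  have h1 : p.strategy.runMeasure.real
      (⋃ i ∈ (Finset.univ : Finset (G.MEC × Fin m)), absorbed i.1 i.2) = 1 := by
    rw [measureReal_biUnion_finset (fun i _ j _ hij => disjoint_absorbed hij)
      fun i _ => measurableSet_absorbed i.1 i.2]
    simp_rw [measureReal_absorbed, sum_mass]
  have h2 : p.strategy.runMeasure
      (⋃ i ∈ (Finset.univ : Finset (G.MEC × Fin m)), absorbed i.1 i.2) = 1 := by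
    rw [measureReal_def, ENNReal.toReal_eq_one_iff] at h1
    exact h1
  have h3 := (prob_compl_eq_zero_iff hm).2 h2
  filter_upwards [measure_eq_zero_iff_ae_notMem.1 h3] with ω hω
  simpa using hω

/-- The reward of a mode. -/
noncomputable def reward {n : ℕ} (r : A → Fin n → ℚ) (i : G.MEC × Fin m) (j : Fin n) : ℝ :=
  ∑ a, p.π i.1 i.2 a * (r a j : ℝ)

theorem ae_lrInf_eq {n : ℕ} (r : A → Fin n → ℚ) : ∀ᵐ ω ∂p.strategy.runMeasure,
    ∀ i : G.MEC × Fin m, ω ∈ absorbed i.1 i.2 → ∀ j, lrInf r ω j = p.reward r i j := by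
  filter_upwards [p.ae_tendsto_freq] with ω hω i hi j
  rw [lrInf_eq_liminf_freq]
  exact (tendsto_finsetSum _ fun a _ => (hω i.1 i.2 hi a).mul_const _).liminf_eq

theorem integral_lrInf {n : ℕ} (r : A → Fin n → ℚ) (j : Fin n) :
    ∫ ω, lrInf r ω j ∂p.strategy.runMeasure = ∑ i, p.mass i * p.reward r i j := by
  have h1 : (fun ω => lrInf r ω j) =ᵐ[p.strategy.runMeasure] fun ω =>
      ∑ i : G.MEC × Fin m, (absorbed i.1 i.2).indicator (fun _ => p.reward r i j) ω := by
    filter_upwards [p.ae_exists_absorbed, p.ae_lrInf_eq r] with ω ⟨i, hi⟩ h2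
    rw [Finset.sum_eq_single i]
    · rw [Set.indicator_of_mem hi, h2 i hi]
    · intro i' _ hne
      exact Set.indicator_of_notMem
        (fun hi' => Set.disjoint_left.1 (disjoint_absorbed hne) hi' hi) _
    · exact fun h => absurd (Finset.mem_univ i) h
  rw [integral_congr_ae h1, integral_finsetSum _ fun i _ =>
    (integrable_const _).indicator (measurableSet_absorbed i.1 i.2)]
  refine Finset.sum_congr rfl fun i _ => ?_
  rw [integral_indicator (measurableSet_absorbed i.1 i.2), setIntegral_const, smul_eq_mul,
    measureReal_absorbed]

end Plan

/-! ### From an arbitrary strategy to a finite-memory one -/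

section Synthesis

open scoped Classical

variable {S A : Type*} [Fintype S] [Fintype A] {G : MDP S A}

theorem abs_sum_mul_reward_le {n : ℕ} {r : A → Fin n → ℚ} {B : ℝ}
    (hB : ∀ a i, |(r a i : ℝ)| ≤ B) {x : A → ℝ} (hx : ∀ a, 0 ≤ x a) (j : Fin n) :
    |∑ a, x a * (r a j : ℝ)| ≤ (∑ a, x a) * B := by
  rw [Finset.sum_mul]
  refine (Finset.abs_sum_le_sum_abs _ _).trans (Finset.sum_le_sum fun a _ => ?_)
  rw [abs_mul, abs_of_nonneg (hx a)]
  exact mul_le_mul_of_nonneg_left (hB a j) (hx a)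

/-- A circulation on an end component is approximated, up to scaling, by distributions of full
support. -/
theorem MDP.IsEndComponent.exists_approximation {B : Set A} (hB : G.IsEndComponent B) {x : A → ℝ}
    (hx : ∀ a, 0 ≤ x a) (hx0 : ∀ a, a ∉ B → x a = 0) (hxc : G.IsCirculation x)
    {n : ℕ} (r : A → Fin n → ℚ) {ε : ℝ} (hε : 0 < ε) :
    ∃ π : A → ℝ, (∀ a ∈ B, 0 < π a) ∧ (∀ a, a ∉ B → π a = 0) ∧ ∑ a, π a = 1 ∧
      G.IsCirculation π ∧
      ∀ j, ∑ a, x a * (r a j : ℝ) ≤ (∑ a, x a) * (∑ a, π a * (r a j : ℝ) + ε) := by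
  obtain ⟨z, hz0, hzB, hz1, hzc⟩ := hB.exists_circulation
  have hz0' : ∀ a, a ∉ B → z a = 0 := fun a ha =>
    le_antisymm (not_lt.1 fun h => ha ((hzB a).1 h)) (hz0 a)
  rcases (Finset.sum_nonneg fun a _ => hx a : 0 ≤ ∑ a, x a).eq_or_lt with hX | hX
  · refine ⟨z, fun a ha => (hzB a).2 ha, hz0', hz1, hzc, fun j => ?_⟩
    have : ∀ a, x a = 0 := fun a =>
      (Finset.sum_eq_zero_iff_of_nonneg fun a _ => hx a).1 hX.symm a (Finset.mem_univ a)
    simp [this]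
  · obtain ⟨b, hb0, hb⟩ := exists_abs_reward_le r
    set X := ∑ a, x a with hXdef
    have hd : 0 < ε + 2 * b := by positivity
    -- Moving a fraction `η` of a distribution onto `z` changes a reward bounded by `b` by at most
    -- `2 * b * η`, which is at most `ε`.
    set η := ε / (ε + 2 * b) with hη
    have hη0 : 0 < η := div_pos hε hd
    have hη1 : η ≤ 1 := (div_le_one hd).2 (by linarith)
    have hηb : η * (2 * b) ≤ ε := by
      rw [hη, div_mul_eq_mul_div, div_le_iff₀ hd]
      nlinarith
    have hc0 : 0 ≤ (1 - η) / X := div_nonneg (by linarith) hX.le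
    refine ⟨fun a => (1 - η) / X * x a + η * z a, fun a ha => ?_, fun a ha => ?_, ?_,
      fun s => ?_, fun j => ?_⟩
    · exact add_pos_of_nonneg_of_pos (mul_nonneg hc0 (hx a)) (mul_pos hη0 ((hzB a).2 ha))
    · simp [hx0 a ha, hz0' a ha]
    · rw [Finset.sum_add_distrib, ← Finset.mul_sum, ← Finset.mul_sum, hz1, ← hXdef,
        div_mul_cancel₀ _ hX.ne']
      ring
    · rw [MDP.inflow_add, MDP.outflow_add, MDP.inflow_smul, MDP.outflow_smul, MDP.inflow_smul,
        MDP.outflow_smul, hxc s, hzc s]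
    · have h1 := abs_le.1 (abs_sum_mul_reward_le hb hx j)
      have h2 := abs_le.1 (abs_sum_mul_reward_le hb hz0 j)
      rw [hz1, one_mul] at h2
      have e : ∑ a, ((1 - η) / X * x a + η * z a) * (r a j : ℝ) =
          (1 - η) / X * ∑ a, x a * (r a j : ℝ) + η * ∑ a, z a * (r a j : ℝ) := by
        rw [Finset.mul_sum, Finset.mul_sum, ← Finset.sum_add_distrib]
        exact Finset.sum_congr rfl fun a _ => by ring
      rw [e]
      set p := ∑ a, x a * (r a j : ℝ)
      set q := ∑ a, z a * (r a j : ℝ)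
      have e2 : X * ((1 - η) / X * p + η * q + ε) = (1 - η) * p + X * (η * q + ε) := by
        field_simp
        ring
      rw [e2]
      have h3 : p ≤ X * b := h1.2
      have h4 : η * p ≤ η * (X * b) := mul_le_mul_of_nonneg_left h3 hη0.le
      have h5 : (X * η) * (-b) ≤ (X * η) * q :=
        mul_le_mul_of_nonneg_left h2.1 (mul_nonneg hX.le hη0.le)
      have h6 : X * (η * (2 * b)) ≤ X * ε := mul_le_mul_of_nonneg_left hηb hX.le
      nlinarith

theorem integral_eq_sum_setIntegral {Ω ι : Type*} [MeasurableSpace Ω] {μ : Measure Ω} [Fintype ι]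
    {E : ι → Set Ω} (hE : ∀ i, MeasurableSet (E i)) (h : ∀ᵐ ω ∂μ, ∃! i, ω ∈ E i) {f : Ω → ℝ}
    (hf : Integrable f μ) : ∫ ω, f ω ∂μ = ∑ i, ∫ ω in E i, f ω ∂μ := by
  have h1 : f =ᵐ[μ] fun ω => ∑ i, (E i).indicator f ω := by
    filter_upwards [h] with ω ⟨i, hi, hu⟩
    rw [Finset.sum_eq_single i (fun i' _ hne => Set.indicator_of_notMem (fun h => hne (hu i' h)) _)
      (fun h => absurd (Finset.mem_univ i) h), Set.indicator_of_mem hi]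
  rw [integral_congr_ae h1, integral_finsetSum _ fun i _ => hf.indicator (hE i)]
  exact Finset.sum_congr rfl fun i _ => integral_indicator (hE i)

/-- Every strategy, with its runs classified by a measurable `κ` with `m` values, is matched up
to `ε` by a strategy with `m + 1` memory elements. -/
theorem exists_strategy_of_classification {M : Type*} [Countable M] (σ : Strategy G M) {n m : ℕ}
    (r : A → Fin n → ℚ) {ε : ℝ} (hε : 0 < ε) (κ : (ℕ → Loc S M A) → Fin m)
    (hκ : ∀ k, MeasurableSet {ω | κ ω = k}) :
    ∃ τ : Strategy G (Fin (m + 1)),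
      (∀ j, ∫ ω, lrInf r ω j ∂σ.runMeasure - ε ≤ ∫ ω, lrInf r ω j ∂τ.runMeasure) ∧
      ∀ (Q : Fin m → Prop) (J : Set (Fin n)) (c : Fin n → ℝ),
        (∀ᵐ ω ∂σ.runMeasure, Q (κ ω) → ∀ j ∈ J, c j ≤ lrInf r ω j) →
        σ.runMeasure.real {ω | Q (κ ω)} ≤
          τ.runMeasure.real {ω | ∀ j ∈ J, c j - ε ≤ lrInf r ω j} := by
  set E : G.MEC × Fin m → Set (ℕ → Loc S M A) := fun i =>
    {ω | κ ω = i.2} ∩ {ω | ∀ᶠ t in atTop, (ω t).act ∈ i.1.1} with hE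
  have hEm : ∀ i, MeasurableSet (E i) := by
    intro i
    refine (hκ i.2).inter ?_
    have : {ω : ℕ → Loc S M A | ∀ᶠ t in atTop, (ω t).act ∈ i.1.1} =
        ⋃ N, ⋂ t ≥ N, {ω | ω t ∈ {l : Loc S M A | l.act ∈ i.1.1}} := by
      ext ω
      simp [eventually_atTop]
    rw [this]
    exact MeasurableSet.iUnion fun N => MeasurableSet.iInter fun t =>
      MeasurableSet.iInter fun _ => MarkovChain.measurableSet_mem _ _
  have hEu : ∀ᵐ ω ∂σ.runMeasure, ∃! i, ω ∈ E i := by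
    filter_upwards [σ.ae_exists_mec] with ω ⟨C, hC⟩
    refine ⟨(C, κ ω), ⟨rfl, hC⟩, fun i hi => Prod.ext ?_ hi.1.symm⟩
    obtain ⟨t, h1, h2⟩ := (hC.and hi.2).exists
    exact MDP.MEC.eq_of_src h2 h1 rfl
  set U : Ultrafilter ℕ := hyperfilter ℕ
  have hU : (U : Filter ℕ) ≤ atTop := Nat.hyperfilter_le_atTop
  choose x hx using fun i => exists_isFreqLimit σ U (E i)
  have hx0 : ∀ i a, a ∉ i.1.1 → x i a = 0 := fun i a ha =>
    (hx i).eq_zero hU (hEm i) (fun ω hω => hω.2) ha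
  have hxE : ∀ i, ∑ a, x i a = σ.runMeasure.real (E i) := fun i => (hx i).sum_eq hU
  -- The pieces partition almost every run and share one ultrafilter, so their limits add up to the
  -- limit for all runs, to which the flow lemma applies.
  have hXlim : IsFreqLimit σ U Set.univ fun a => ∑ i, x i a := by
    intro a
    refine (tendsto_finsetSum _ fun i _ => hx i a).congr fun T => ?_
    rw [setIntegral_univ]
    exact (integral_eq_sum_setIntegral hEm hEu (integrable_freq _ T a)).symm
  obtain ⟨y, hy0, hy⟩ := hXlim.exists_flow hU
  choose π hπ1 hπ2 hπ3 hπ4 hπ5 using fun i : G.MEC × Fin m =>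
    i.1.isEndComponent.exists_approximation (fun a => (hx i).nonneg a) (hx0 i)
      ((hx i).isCirculation hU) r hε
  let p : Plan G m :=
    { y := y
      x := fun C k => x (C, k)
      π := fun C k => π (C, k)
      y_nonneg := hy0
      x_nonneg := fun C k => (hx (C, k)).nonneg
      x_zero := fun C k => hx0 (C, k)
      flow := fun s => by
        rw [hy s, MDP.outflow_sum, Fintype.sum_prod_type_right]
      π_pos := fun C k => hπ1 (C, k)
      π_zero := fun C k => hπ2 (C, k)
      π_sum := fun C k => hπ3 (C, k)
      π_circulation := fun C k => hπ4 (C, k) }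
  have hmass : ∀ i, p.mass i = σ.runMeasure.real (E i) := hxE
  have hrew : ∀ i j, ∫ ω in E i, lrInf r ω j ∂σ.runMeasure ≤ p.mass i * (p.reward r i j + ε) :=
    fun i j => ((hx i).setIntegral_lrInf_le hU r j).trans (hπ5 i j)
  refine ⟨p.strategy, fun j => ?_, fun Q J c hQ => ?_⟩
  · rw [integral_eq_sum_setIntegral hEm hEu (integrable_lrInf σ r j), p.integral_lrInf]
    have h1 := Finset.sum_le_sum fun i (_ : i ∈ Finset.univ) => hrew i j
    simp only [mul_add, Finset.sum_add_distrib, ← Finset.sum_mul, p.sum_mass, one_mul] at h1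
    linarith
  -- On a piece of positive mass the bound `c j` holds for almost every run, hence for the mean;
  -- dividing by the mass transfers it to the constant reward of the mode. Pieces of mass zero carry
  -- no such information and are discarded below.
  · have h1 : ∀ i, Q i.2 → p.mass i ≠ 0 → ∀ j ∈ J, c j - ε ≤ p.reward r i j := by
      intro i hi hm j hj
      have hpos : 0 < p.mass i := lt_of_le_of_ne (by rw [hmass]; exact measureReal_nonneg) hm.symm
      have h2 : p.mass i * c j ≤ p.mass i * (p.reward r i j + ε) := by
        refine le_trans ?_ (hrew i j)
        rw [hmass, ← smul_eq_mul, ← setIntegral_const]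
        refine setIntegral_mono_on_ae (integrable_const _).integrableOn
          (integrable_lrInf σ r j).integrableOn (hEm i) ?_
        filter_upwards [hQ] with ω hω hωE
        have hki : κ ω = i.2 := hωE.1
        exact hω (hki ▸ hi) j hj
      linarith [le_of_mul_le_mul_left h2 hpos]
    calc σ.runMeasure.real {ω | Q (κ ω)}
        ≤ ∑ i with Q i.2 ∧ p.mass i ≠ 0, σ.runMeasure.real (E i) := by
          have h3 : ∑ i with Q i.2 ∧ p.mass i ≠ 0, σ.runMeasure.real (E i) =
              ∑ i with Q i.2, σ.runMeasure.real (E i) := by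
            refine Finset.sum_subset (fun i => by simp +contextual) fun i hi hi' => ?_
            simp only [Finset.mem_filter, Finset.mem_univ, true_and, not_and, not_not] at hi hi'
            rw [← hmass]
            exact hi' hi
          rw [h3]
          refine le_trans ?_ (measureReal_biUnion_finset_le _ _)
          refine ENNReal.toReal_mono (measure_ne_top _ _) (measure_mono_ae ?_)
          filter_upwards [hEu] with ω ⟨i, hi, _⟩ hω
          have hki : κ ω = i.2 := hi.1
          have hω' : Q (κ ω) := hω
          exact Set.mem_biUnion (x := i) (by simpa [← hki] using hω') hi
      _ = ∑ i with Q i.2 ∧ p.mass i ≠ 0, p.strategy.runMeasure.real (Plan.absorbed i.1 i.2) :=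
          Finset.sum_congr rfl fun i _ => by rw [p.measureReal_absorbed, hmass]
      _ = p.strategy.runMeasure.real
            (⋃ i ∈ Finset.univ.filter fun i : G.MEC × Fin m => Q i.2 ∧ p.mass i ≠ 0,
              Plan.absorbed i.1 i.2) :=
          (measureReal_biUnion_finset (fun i _ j _ hij => Plan.disjoint_absorbed hij)
            fun i _ => Plan.measurableSet_absorbed i.1 i.2).symm
      _ ≤ _ := by
          refine ENNReal.toReal_mono (measure_ne_top _ _) (measure_mono_ae ?_)
          filter_upwards [p.ae_lrInf_eq r] with ω h2 h3 j hj
          obtain ⟨i, hi, hi'⟩ := Set.mem_iUnion₂.1 h3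
          simp only [Finset.mem_filter, Finset.mem_univ, true_and] at hi
          rw [h2 i hi' j]
          exact h1 i hi.1 hi.2 j hj

/-- Finitely many satisfaction constraints, and the expectations, are preserved up to `ε` by a
strategy with a memory element for each set of constraints and one more. -/
theorem exists_strategy_of_constraints {M : Type*} [Countable M] (σ : Strategy G M) {n : ℕ}
    (r : A → Fin n → ℚ) {ε : ℝ} (hε : 0 < ε) {ι : Type*} [Fintype ι] {d : ℕ} (hd : Fintype.card ι = d)
    (J : ι → Set (Fin n)) (c : ι → Fin n → ℝ) :
    ∃ τ : Strategy G (Fin (2 ^ d + 1)),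
      (∀ j, ∫ ω, lrInf r ω j ∂σ.runMeasure - ε ≤ ∫ ω, lrInf r ω j ∂τ.runMeasure) ∧
      ∀ i, σ.runMeasure.real {ω | ∀ j ∈ J i, c i j ≤ lrInf r ω j} ≤
        τ.runMeasure.real {ω | ∀ j ∈ J i, c i j - ε ≤ lrInf r ω j} := by
  subst hd
  -- The class of a run is the exact set of constraints that it satisfies.
  let e : Set ι ≃ Fin (2 ^ Fintype.card ι) := Fintype.equivFinOfCardEq Fintype.card_set
  have hP : ∀ i, MeasurableSet {ω : ℕ → Loc S M A | ∀ j ∈ J i, c i j ≤ lrInf r ω j} := by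
    intro i
    have : {ω : ℕ → Loc S M A | ∀ j ∈ J i, c i j ≤ lrInf r ω j} =
        ⋂ j ∈ J i, {ω | c i j ≤ lrInf r ω j} := by
      ext ω; simp
    rw [this]
    exact MeasurableSet.biInter (J i).to_countable fun j _ =>
      measurableSet_le measurable_const (measurable_lrInf r j)
  obtain ⟨τ, h1, h2⟩ := exists_strategy_of_classification σ r hε
    (fun ω => e {i | ∀ j ∈ J i, c i j ≤ lrInf r ω j}) (fun k => by
      have : {ω : ℕ → Loc S M A | e {i | ∀ j ∈ J i, c i j ≤ lrInf r ω j} = k} =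
          ⋂ i, {ω | (∀ j ∈ J i, c i j ≤ lrInf r ω j) ↔ i ∈ e.symm k} := by
        ext ω
        simp [← Equiv.eq_symm_apply, Set.ext_iff]
      rw [this]
      refine MeasurableSet.iInter fun i => ?_
      by_cases hi : i ∈ e.symm k
      · simpa [hi] using hP i
      · simp only [hi, iff_false]
        exact (hP i).compl)
  refine ⟨τ, h1, fun i => ?_⟩
  have h3 := h2 (fun k => i ∈ e.symm k) (J i) (c i) (Eventually.of_forall fun ω hω => by
    simpa using hω)
  simpa using h3

end Synthesis

/-! ### The four memory bounds -/

theorem mainTheorem7 {S A : Type*} [Finite S] [Finite A] (G : MDP S A) (n : ℕ)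
    (r : A → Fin n → ℚ) (ε : ℝ) (hε : 0 < ε) :
    -- (multi-qual): 2 memory elements
    (∀ exp sat : Fin n → ℚ,
      Realizable G (MultiQual r (fun i => (exp i : ℝ)) (fun i => (sat i : ℝ))) →
      RealizableWithMemory G 2
        (MultiQual r (fun i => (exp i : ℝ) - ε) (fun i => (sat i : ℝ) - ε))) ∧
    -- (multi-quant-joint): 3 memory elements
    (∀ (exp sat : Fin n → ℚ) (pr : ℝ), pr ∈ Set.Icc (0 : ℝ) 1 →
      Realizable G (MultiQuantJoint r (fun i => (exp i : ℝ)) (fun i => (sat i : ℝ)) pr) →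
      RealizableWithMemory G 3
        (MultiQuantJoint r (fun i => (exp i : ℝ) - ε) (fun i => (sat i : ℝ) - ε) pr)) ∧
    -- (multi-quant-conjunctive): 2 ^ n + 1 memory elements
    (∀ exp sat pr : Fin n → ℚ, (∀ i, pr i ∈ Set.Icc (0 : ℚ) 1) →
      Realizable G (MultiQuantConjunctive r (fun i => (exp i : ℝ)) (fun i => (sat i : ℝ))
        (fun i => (pr i : ℝ))) →
      RealizableWithMemory G (2 ^ n + 1)
        (MultiQuantConjunctive r (fun i => (exp i : ℝ) - ε) (fun i => (sat i : ℝ) - ε)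
          (fun i => (pr i : ℝ)))) ∧
    -- (multi-quant-conjunctive-joint): 2 ^ (n + 1) + 1 memory elements
    (∀ (exp sat pr sat' : Fin n → ℚ) (pr' : ℚ), (∀ i, pr i ∈ Set.Icc (0 : ℚ) 1) →
      pr' ∈ Set.Icc (0 : ℚ) 1 →
      Realizable G (MultiQuantConjunctiveJoint r (fun i => (exp i : ℝ)) (fun i => (sat i : ℝ))
        (fun i => (pr i : ℝ)) (fun i => (sat' i : ℝ)) (pr' : ℝ)) →
      RealizableWithMemory G (2 ^ (n + 1) + 1)
        (MultiQuantConjunctiveJoint r (fun i => (exp i : ℝ) - ε) (fun i => (sat i : ℝ) - ε)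
          (fun i => (pr i : ℝ)) (fun i => (sat' i : ℝ) - ε) (pr' : ℝ))) := by

  obtain ⟨_⟩ := nonempty_fintype S
  obtain ⟨_⟩ := nonempty_fintype A
  refine ⟨?_, ?_, ?_, ?_⟩
  · rintro exp sat ⟨M, _, σ, hexp, hsat⟩
    -- Each constraint holds almost surely, so there is nothing to distinguish and one class
    -- suffices.
    obtain ⟨τ, h1, h2⟩ := exists_strategy_of_classification σ r hε (m := 1) (fun _ => 0)
      fun k => MeasurableSet.const _
    refine ⟨τ, fun i => (sub_le_sub_right (hexp i) ε).trans (h1 i), fun i => ?_⟩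
    have h3 : ∀ᵐ ω ∂σ.runMeasure, (sat i : ℝ) ≤ lrInf r ω i := by
      have hm : MeasurableSet {ω : ℕ → Loc S M A | (sat i : ℝ) ≤ lrInf r ω i} :=
        measurableSet_le measurable_const (measurable_lrInf r i)
      have h4 := le_antisymm measureReal_le_one (hsat i)
      rw [measureReal_def, ENNReal.toReal_eq_one_iff] at h4
      exact (prob_compl_eq_zero_iff hm).2 h4
    have h5 := h2 (fun _ => True) {i} (fun i => sat i) (by
      filter_upwards [h3] with ω hω _ j hj
      rw [Set.mem_singleton_iff.1 hj]
      exact hω)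
    simpa using h5
  · rintro exp sat pr - ⟨M, _, σ, hexp, hsat⟩
    -- The joint constraint is a single event, giving `2 ^ 1 + 1 = 3` memory elements.
    obtain ⟨τ, h1, h2⟩ := exists_strategy_of_constraints σ r hε (ι := Unit) (d := 1) rfl
      (fun _ => Set.univ) (fun _ i => sat i)
    refine ⟨τ, fun i => (sub_le_sub_right (hexp i) ε).trans (h1 i), hsat.trans ?_⟩
    simpa using h2 ()
  · rintro exp sat pr - ⟨M, _, σ, hexp, hsat⟩
    obtain ⟨τ, h1, h2⟩ := exists_strategy_of_constraints σ r hε (ι := Fin n) (d := n) (by simp)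
      (fun i => {i}) (fun _ i => sat i)
    refine ⟨τ, fun i => (sub_le_sub_right (hexp i) ε).trans (h1 i), fun i => (hsat i).trans ?_⟩
    simpa using h2 i
  · rintro exp sat pr sat' pr' - - ⟨M, _, σ, hexp, hsat, hjoint⟩
    -- `none` stands for the joint constraint on all components, `some i` for the constraint on
    -- component `i`.
    obtain ⟨τ, h1, h2⟩ := exists_strategy_of_constraints σ r hε (ι := Option (Fin n)) (d := n + 1)
      (by simp) (fun o => o.elim Set.univ fun i => {i})
      (fun o i => o.elim (sat' i : ℝ) fun _ => (sat i : ℝ))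
    refine ⟨τ, fun i => (sub_le_sub_right (hexp i) ε).trans (h1 i), fun i => (hsat i).trans ?_,
      hjoint.trans ?_⟩
    · simpa using h2 (some i)
    · simpa using h2 none
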